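/- Let $n,m\ge 1$, $0<\sigma\le 1$, $\bar A\in[-1,1]^{n\times m}$, and let $A=\bar A+G$, where the entries of $G\in\mathbb{R}^{n\times m}$ are independent Gaussian random variables with mean $0$ and variance $\sigma^2$. Write $\Delta^d=\{x\in\mathbb{R}_{\ge 0}^d:\sum_i x_i=1\}$ and $\mathcal{Z}=\Delta^n\times\Delta^m$. For $z=(x,y)\in\mathcal{Z}$ let $$\Phi(z)=\max_{y'\in\Delta^m}\langle x,Ay'\rangle-\min_{x'\in\Delta^n}\langle x',Ay\rangle$$ be the duality gap of the zero-sum game $\min_{x\in\Delta^n}\max_{y\in\Delta^m}\langle x,Ay\rangle$. Let $v$ be the value of this game, and let $\mathcal{Z}^\star=\mathcal{X}^\star\times\mathcal{Y}^\star$ be its set of equilibria, where $\mathcal{X}^\star=\{x\in\Delta^n:\max_{y'\in\Delta^m}\langle x,Ay'\rangle\le v\}$ and $\mathcal{Y}^\star=\{y\in\Delta^m:\min_{x'\in\Delta^n}\langle x',Ay\rangle\ge v\}$; $\Pi_{\mathcal{Z}^\star}$ denotes the Euclidean projection onto $\mathcal{Z}^\star$. Then, with high probability, the game satisfies the error bound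 with a modulus $\kappa$ polynomial in $\sigma$ and $1/(nm)$. Precisely: for every real $K>0$ and every integer $c\ge 0$ there are a real $C>0$ and integers $a,b\ge 0$, depending only on $K$ and $c$, such that for all $n,m,\sigma,\bar A$ as above, with probability at least $1-\frac{1}{K(nm)^c}$ over $G$, every $\kappa$ with $0<\kappa\le C\,\sigma^a\,(1/(nm))^b$ satisfies $$\Phi(z)\ \ge\ \kappa\,\|z-\Pi_{\mathcal{Z}^\star}(z)\|\qquad\text{for all } z\in\mathcal{Z}.$$ -/

import Mathlib

open MeasureTheory ProbabilityTheory

noncomputable section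

namespace ZeroSumGame

variable {n m : ℕ}

/-- The bilinear payoff `⟨x, A y⟩`; Player `x` minimizes and Player `y` maximizes it. -/
def payoff (A : Matrix (Fin n) (Fin m) ℝ) (x : Fin n → ℝ) (y : Fin m → ℝ) : ℝ :=
  x ⬝ᵥ (A.mulVec y)

/-- `max_{y' ∈ Δ^m} ⟨x, A y'⟩`. The supremum is attained because the simplex is compact. -/
def maxPayoff (A : Matrix (Fin n) (Fin m) ℝ) (x : Fin n → ℝ) : ℝ :=
  ⨆ y' : stdSimplex ℝ (Fin m), payoff A x (y' : Fin m → ℝ)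

/-- `min_{x' ∈ Δ^n} ⟨x', A y⟩`. The infimum is attained because the simplex is compact. -/
def minPayoff (A : Matrix (Fin n) (Fin m) ℝ) (y : Fin m → ℝ) : ℝ :=
  ⨅ x' : stdSimplex ℝ (Fin n), payoff A (x' : Fin n → ℝ) y

/-- The duality gap `Φ(x, y) = max_{y'} ⟨x, A y'⟩ - min_{x'} ⟨x', A y⟩`. -/
def dualityGap (A : Matrix (Fin n) (Fin m) ℝ) (x : Fin n → ℝ) (y : Fin m → ℝ) : ℝ :=
  maxPayoff A x - minPayoff A y

/-- The value `v = min_{x ∈ Δ^n} max_{y ∈ Δ^m} ⟨x, A y⟩` of the game. -/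
def value (A : Matrix (Fin n) (Fin m) ℝ) : ℝ :=
  ⨅ x : stdSimplex ℝ (Fin n), maxPayoff A (x : Fin n → ℝ)

/-- The set `X⋆` of equilibrium (optimal) strategies of Player `x`. -/
def optX (A : Matrix (Fin n) (Fin m) ℝ) : Set (Fin n → ℝ) :=
  {x | x ∈ stdSimplex ℝ (Fin n) ∧ maxPayoff A x ≤ value A}

/-- The set `Y⋆` of equilibrium (optimal) strategies of Player `y`. -/
def optY (A : Matrix (Fin n) (Fin m) ℝ) : Set (Fin m → ℝ) :=
  {y | y ∈ stdSimplex ℝ (Fin m) ∧ value A ≤ minPayoff A y}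

/-- The Euclidean norm on `ℝ^n × ℝ^m = ℝ^(n+m)`. -/
def pairNorm (z : (Fin n → ℝ) × (Fin m → ℝ)) : ℝ :=
  ‖WithLp.toLp 2 (WithLp.toLp 2 z.1, WithLp.toLp 2 z.2)‖

/-- `p` is the Euclidean projection of `z` onto `S`: a point of `S` closest to `z`
(it is unique when `S` is convex). -/
def IsProjection (S : Set ((Fin n → ℝ) × (Fin m → ℝ))) (z p : (Fin n → ℝ) × (Fin m → ℝ)) : Prop :=
  p ∈ S ∧ ∀ q ∈ S, pairNorm (z - p) ≤ pairNorm (z - q)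

/-- The game `A` satisfies the error bound with modulus `κ > 0`: every `z ∈ Z = Δ^n × Δ^m` has a
projection `p` onto `Z⋆ = X⋆ × Y⋆`, and `Φ(z) ≥ κ ‖z - p‖`. -/
def ErrorBound (A : Matrix (Fin n) (Fin m) ℝ) (κ : ℝ) : Prop :=
  0 < κ ∧ ∀ z ∈ stdSimplex ℝ (Fin n) ×ˢ stdSimplex ℝ (Fin m),
    ∃ p, IsProjection (optX A ×ˢ optY A) z p ∧ κ * pairNorm (z - p) ≤ dualityGap A z.1 z.2

/-- The law of `n m` independent centered Gaussian random variables with variance `σ ^ 2`. -/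
def gaussianNoise (n m : ℕ) (σ : ℝ) : Measure (Fin n × Fin m → ℝ) :=
  Measure.pi fun _ => gaussianReal 0 (σ ^ 2).toNNReal

/-- The perturbed payoff matrix `A = Ā + G`. -/
def perturbed (Abar : Matrix (Fin n) (Fin m) ℝ) (G : Fin n × Fin m → ℝ) :
    Matrix (Fin n) (Fin m) ℝ :=
  Abar + Matrix.of fun i j => G (i, j)

end ZeroSumGame

end

/-! By the minimax theorem the duality gap splits into the two players' excesses `worst A x -
gameValue A` (for the other player, in the game `negTranspose A`). It suffices that each excess
grows linearly in the distance to some optimal strategy.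

Deterministic half (`linear_growth`): suppose that near-optimal strategies are close together, that
slack columns at the optimum `x₀` are slack by a margin, and that nonzero weights of `x₀` are
bounded below. If growth failed at `x`, then the point of the ray from `x₀` through `x` at
sup-distance `η` would still be a strategy and still near-optimal, contradicting closeness. The
margin on columns comes from `slack_of_colDichotomy`, the bound on weights from
`weight_of_rowDichotomy`; both rest on `ColDichotomy` and `IsRobust`, for the game, its dual, and
the dual with a column deleted.

Probabilistic half: moving the noise by a vector short compared with `σ` changes expectations of
bounded functions little (`abs_integral_shift_sub_le`). Adding a constant to a row or a column is
such a move. The value is concave under row shifts, and two distant near-optimal strategies force a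
large second difference. Its expectation compares a bounded increment at two shifted noises, so it
is small (`measure_secondDiff_le`). Likewise, the event that a column is useless is monotone in that
column's shift, so its status is rarely unstable (`measure_not_colDichotomy_le`). A union bound with
polynomially chosen scales concludes. -/

namespace ZeroSumGame

/-! ### Matrix games: the value, its continuity, and minimax. -/

section Deterministic

open Matrix Finset

variable {ι κ : Type*} [Fintype ι] [Fintype κ]

/-- The largest payoff over the pure strategies of the maximizer against `x`. -/
noncomputable def worst [Nonempty κ] (A : Matrix ι κ ℝ) (x : ι → ℝ) : ℝ :=
  univ.sup' univ_nonempty (fun j => (x ᵥ* A) j)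

/-- The minimax value of a matrix game over arbitrary finite strategy sets. -/
noncomputable def gameValue [Nonempty κ] (A : Matrix ι κ ℝ) : ℝ :=
  ⨅ x : stdSimplex ℝ ι, worst A (x : ι → ℝ)

theorem le_worst [Nonempty κ] (A : Matrix ι κ ℝ) (x : ι → ℝ) (j : κ) :
    (x ᵥ* A) j ≤ worst A x :=
  le_sup' (fun j => (x ᵥ* A) j) (mem_univ j)

theorem worst_le_iff [Nonempty κ] {A : Matrix ι κ ℝ} {x : ι → ℝ} {t : ℝ} :
    worst A x ≤ t ↔ ∀ j, (x ᵥ* A) j ≤ t := by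
  simp [worst]

theorem exists_worst_eq [Nonempty κ] (A : Matrix ι κ ℝ) (x : ι → ℝ) :
    ∃ j, worst A x = (x ᵥ* A) j := by
  obtain ⟨j, -, hj⟩ := exists_mem_eq_sup' (univ_nonempty (α := κ)) (fun j => (x ᵥ* A) j)
  exact ⟨j, hj⟩

theorem continuous_worst [Nonempty κ] (A : Matrix ι κ ℝ) : Continuous (worst A) := by
  unfold worst
  refine Continuous.finset_sup'_apply _ fun j _ => ?_
  simp only [vecMul, dotProduct]
  fun_prop

theorem stdSimplex_nonempty [Nonempty ι] : (stdSimplex ℝ ι).Nonempty := by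
  classical
  exact ⟨_, single_mem_stdSimplex ℝ (Classical.arbitrary ι)⟩

theorem exists_worst_le [Nonempty ι] [Nonempty κ] (A : Matrix ι κ ℝ) :
    ∃ x ∈ stdSimplex ℝ ι, ∀ x' ∈ stdSimplex ℝ ι, worst A x ≤ worst A x' :=
  (isCompact_stdSimplex ℝ ι).exists_isMinOn stdSimplex_nonempty (continuous_worst A).continuousOn

theorem gameValue_le [Nonempty ι] [Nonempty κ] (A : Matrix ι κ ℝ) {x : ι → ℝ}
    (hx : x ∈ stdSimplex ℝ ι) : gameValue A ≤ worst A x := by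
  obtain ⟨x₀, -, h⟩ := exists_worst_le A
  exact ciInf_le ⟨worst A x₀, by rintro _ ⟨x', rfl⟩; exact h x' x'.2⟩
    (⟨x, hx⟩ : stdSimplex ℝ ι)

theorem exists_worst_eq_gameValue [Nonempty ι] [Nonempty κ] (A : Matrix ι κ ℝ) :
    ∃ x ∈ stdSimplex ℝ ι, worst A x = gameValue A := by
  obtain ⟨x₀, hx₀, h⟩ := exists_worst_le A
  have : Nonempty (stdSimplex ℝ ι) := ⟨⟨x₀, hx₀⟩⟩
  exact ⟨x₀, hx₀, le_antisymm (le_ciInf fun x => h x x.2) (gameValue_le A hx₀)⟩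

/-- An optimal strategy for `B` loses at most `c` when used in `A`. This yields monotonicity (`c =
0`) as well as continuity of the value. -/
theorem gameValue_le_add [Nonempty ι] [Nonempty κ] {A B : Matrix ι κ ℝ} {c : ℝ}
    (h : ∀ i j, A i j ≤ B i j + c) : gameValue A ≤ gameValue B + c := by
  obtain ⟨x, hx, hxB⟩ := exists_worst_eq_gameValue B
  refine (gameValue_le A hx).trans (worst_le_iff.2 fun j => ?_)
  rw [← hxB]
  calc (x ᵥ* A) j ≤ (x ᵥ* B) j + c := by
        simp only [vecMul, dotProduct]
        calc ∑ i, x i * A i j ≤ ∑ i, (x i * B i j + x i * c) :=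
              sum_le_sum fun i _ => by nlinarith [hx.1 i, h i j]
          _ = _ := by rw [sum_add_distrib, ← sum_mul, hx.2, one_mul]
    _ ≤ _ := by linarith [le_worst B x j]

theorem continuous_gameValue [Nonempty ι] [Nonempty κ] :
    Continuous (gameValue : Matrix ι κ ℝ → ℝ) := by
  refine continuous_iff_continuousAt.2 fun A => Metric.tendsto_nhds.2 fun ε hε => ?_
  have h : ∀ᶠ B in nhds A, ∀ i j, dist (B i j) (A i j) < ε / 2 := by
    refine Filter.eventually_all.2 fun i => Filter.eventually_all.2 fun j => ?_
    have hc : Continuous fun B : Matrix ι κ ℝ => B i j := by fun_prop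
    exact Metric.tendsto_nhds.1 hc.continuousAt _ (half_pos hε)
  filter_upwards [h] with B hB
  have h1 : gameValue B ≤ gameValue A + ε / 2 := gameValue_le_add fun i j => by
    have := abs_lt.1 (hB i j); linarith
  have h2 : gameValue A ≤ gameValue B + ε / 2 := gameValue_le_add fun i j => by
    have := abs_lt.1 (hB i j); linarith
  rw [Real.dist_eq, abs_lt]
  constructor <;> linarith

theorem vecMul_dotProduct_le [Nonempty κ] (A : Matrix ι κ ℝ) (x : ι → ℝ) {y : κ → ℝ}
    (hy : y ∈ stdSimplex ℝ κ) : (x ᵥ* A) ⬝ᵥ y ≤ worst A x := by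
  calc (x ᵥ* A) ⬝ᵥ y ≤ ∑ j, worst A x * y j :=
        sum_le_sum fun j _ => mul_le_mul_of_nonneg_right (le_worst A x j) (hy.1 j)
    _ = worst A x := by rw [← mul_sum, hy.2, mul_one]

/-- The same game seen by the other player. -/
def negTranspose {ι κ : Type*} (A : Matrix ι κ ℝ) : Matrix κ ι ℝ := -Aᵀ

@[simp] theorem negTranspose_apply {ι κ : Type*} (A : Matrix ι κ ℝ) (i : ι) (j : κ) :
    negTranspose A j i = -A i j := rfl

theorem vecMul_negTranspose {ι κ : Type*} [Fintype κ] (A : Matrix ι κ ℝ) (y : κ → ℝ) (i : ι) :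
    (y ᵥ* negTranspose A) i = -(A *ᵥ y) i := by
  simp [vecMul, mulVec, dotProduct, mul_comm]

/-- von Neumann's minimax theorem. -/
theorem gameValue_negTranspose [Nonempty ι] [Nonempty κ] (A : Matrix ι κ ℝ) :
    gameValue (negTranspose A) = -gameValue A := by
  classical
  have key : ∀ (x : ι → ℝ) (y : κ → ℝ),
      (y ᵥ* negTranspose A) ⬝ᵥ x = -((x ᵥ* A) ⬝ᵥ y) := by
    intro x y
    have : y ᵥ* negTranspose A = -(A *ᵥ y) := by
      ext i; simp [vecMul_negTranspose]
    rw [this, neg_dotProduct, dotProduct_comm, dotProduct_mulVec]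
  apply le_antisymm
  -- A saddle point of the bilinear payoff; testing it against pure strategies bounds both worst
  -- cases by the same number.
  · obtain ⟨a, ha, b, hb, hab⟩ := Sion.exists_isSaddlePointOn
      (X := stdSimplex ℝ ι) (Y := stdSimplex ℝ κ)
      (f := fun x y => (x ᵥ* A) ⬝ᵥ y) stdSimplex_nonempty (convex_stdSimplex ℝ ι)
      (isCompact_stdSimplex ℝ ι)
      (fun y _ => ContinuousOn.lowerSemicontinuousOn <| Continuous.continuousOn
        (by simp only [vecMul, dotProduct]; fun_prop))
      (fun y _ => ConvexOn.quasiconvexOn ⟨convex_stdSimplex ℝ ι, fun u _ v _ s t _ _ _ => by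
        simp [add_vecMul, smul_vecMul, add_dotProduct]⟩)
      (convex_stdSimplex ℝ κ) stdSimplex_nonempty (isCompact_stdSimplex ℝ κ)
      (fun x _ => ContinuousOn.upperSemicontinuousOn <| Continuous.continuousOn
        (by simp only [dotProduct]; fun_prop))
      (fun x _ => ConcaveOn.quasiconcaveOn ⟨convex_stdSimplex ℝ κ, fun u _ v _ s t _ _ _ => by
        simp [dotProduct_add]⟩)
    have h1 : worst A a ≤ (a ᵥ* A) ⬝ᵥ b := worst_le_iff.2 fun j => by
      simpa using hab a ha (Pi.single j 1) (single_mem_stdSimplex ℝ j)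
    have h2 : worst (negTranspose A) b ≤ -((a ᵥ* A) ⬝ᵥ b) := worst_le_iff.2 fun i => by
      have h := hab (Pi.single i 1) (single_mem_stdSimplex ℝ i) b hb
      have h' := key (Pi.single i 1) b
      simp only [dotProduct_single, mul_one] at h'
      simp only at h
      linarith
    linarith [gameValue_le A ha, gameValue_le (negTranspose A) hb]
  · obtain ⟨x, hx, hxA⟩ := exists_worst_eq_gameValue A
    obtain ⟨y, hy, hyA⟩ := exists_worst_eq_gameValue (negTranspose A)
    have h1 := vecMul_dotProduct_le A x hy
    have h2 := vecMul_dotProduct_le (negTranspose A) y hx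
    rw [key] at h2
    linarith

end Deterministic

/-! ### Stability under row and column shifts, and the linear growth it implies. -/

section Perturbations

open Matrix Finset

/-- The matrix with ones in row `i` and zeros elsewhere. -/
def rowOnes {ι : Type*} [DecidableEq ι] (κ : Type*) (i : ι) : Matrix ι κ ℝ :=
  Matrix.of fun i' _ => if i' = i then 1 else 0

/-- The matrix with ones in column `j` and zeros elsewhere. -/
def colOnes (ι : Type*) {κ : Type*} [DecidableEq κ] (j : κ) : Matrix ι κ ℝ :=
  Matrix.of fun _ j' => if j' = j then 1 else 0

/-- The game in which the maximizer may not play `j`. -/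
def deleteCol {ι κ : Type*} (A : Matrix ι κ ℝ) (j : κ) : Matrix ι {k : κ // k ≠ j} ℝ :=
  A.submatrix id Subtype.val

theorem negTranspose_add_smul_colOnes {ι κ : Type*} [DecidableEq κ] (A : Matrix ι κ ℝ) (h : ℝ)
    (j : κ) : negTranspose (A + h • colOnes ι j) = negTranspose A + (-h) • rowOnes ι j := by
  ext; simp [colOnes, rowOnes]; ring

theorem negTranspose_add_smul_rowOnes {ι κ : Type*} [DecidableEq ι] (A : Matrix ι κ ℝ) (h : ℝ)
    (i : ι) : negTranspose (A + h • rowOnes κ i) = negTranspose A + (-h) • colOnes κ i := by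
  ext; simp [colOnes, rowOnes]; ring

theorem deleteCol_add_smul_rowOnes {ι κ : Type*} [DecidableEq ι] (A : Matrix ι κ ℝ) (h : ℝ)
    (i : ι) (j : κ) : deleteCol (A + h • rowOnes κ i) j = deleteCol A j + h • rowOnes _ i := by
  ext; simp [deleteCol, rowOnes]

theorem deleteCol_add_smul_colOnes {ι κ : Type*} [DecidableEq κ] (A : Matrix ι κ ℝ) (h : ℝ)
    (j : κ) : deleteCol (A + h • colOnes ι j) j = deleteCol A j := by
  ext i ⟨k, hk⟩; simp [deleteCol, colOnes, hk]

variable {ι κ : Type*} [Fintype ι] [Fintype κ]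

theorem vecMul_add_smul_rowOnes {ι κ : Type*} [Fintype ι] [DecidableEq ι] (A : Matrix ι κ ℝ) (h : ℝ) (i : ι) (x : ι → ℝ)
    (j : κ) : (x ᵥ* (A + h • rowOnes κ i)) j = (x ᵥ* A) j + h * x i := by
  rw [vecMul_add, vecMul_smul]
  simp [rowOnes, vecMul, dotProduct]

theorem vecMul_add_smul_colOnes {ι κ : Type*} [Fintype ι] [DecidableEq κ] (A : Matrix ι κ ℝ)
    (h : ℝ) (j : κ) {x : ι → ℝ} (hx : x ∈ stdSimplex ℝ ι) (j' : κ) :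
    (x ᵥ* (A + h • colOnes ι j)) j' = (x ᵥ* A) j' + if j' = j then h else 0 := by
  rw [vecMul_add, vecMul_smul]
  split_ifs with hj <;> simp [colOnes, vecMul, dotProduct, hj, hx.2]

theorem worst_add_smul_rowOnes [DecidableEq ι] [Nonempty κ] (A : Matrix ι κ ℝ) (h : ℝ) (i : ι)
    (x : ι → ℝ) : worst (A + h • rowOnes κ i) x = worst A x + h * x i := by
  apply le_antisymm
  · refine worst_le_iff.2 fun j => ?_
    rw [vecMul_add_smul_rowOnes]
    linarith [le_worst A x j]
  · obtain ⟨j, hj⟩ := exists_worst_eq A x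
    rw [hj, ← vecMul_add_smul_rowOnes]
    exact le_worst _ x j

theorem worst_deleteCol_le [DecidableEq κ] [Nonempty κ] (A : Matrix ι κ ℝ) (j : κ) [Nonempty {k // k ≠ j}]
    (x : ι → ℝ) : worst (deleteCol A j) x ≤ worst A x :=
  worst_le_iff.2 fun k => le_worst A x k

theorem gameValue_deleteCol_le [DecidableEq κ] [Nonempty ι] [Nonempty κ] (A : Matrix ι κ ℝ) (j : κ)
    [Nonempty {k // k ≠ j}] : gameValue (deleteCol A j) ≤ gameValue A := by
  obtain ⟨x, hx, hxA⟩ := exists_worst_eq_gameValue A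
  exact (gameValue_le _ hx).trans (hxA ▸ worst_deleteCol_le A j x)

/-- `x` is a strategy whose worst case is within `τ` of the value. -/
def IsNearOpt [Nonempty κ] (A : Matrix ι κ ℝ) (τ : ℝ) (x : ι → ℝ) : Prop :=
  x ∈ stdSimplex ℝ ι ∧ worst A x ≤ gameValue A + τ

/-- Any two `τ`-near-optimal strategies differ by less than `η` in each coordinate. -/
def IsRobust [Nonempty κ] (A : Matrix ι κ ℝ) (η τ : ℝ) : Prop :=
  ∀ x x', IsNearOpt A τ x → IsNearOpt A τ x' → ∀ i, x i - x' i < η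

/-- Every column is needed by the maximizer, or useless to him, and remains so when its payoff
changes by `ε`. -/
def ColDichotomy [DecidableEq κ] [Nonempty κ] (A : Matrix ι κ ℝ) (ε : ℝ) : Prop :=
  ∀ j : κ, ∀ _ : Nonempty {k // k ≠ j},
    gameValue (A + ε • colOnes ι j) ≤ gameValue (deleteCol A j) ∨
      gameValue (deleteCol A j) < gameValue (A + (-ε) • colOnes ι j)

/-- The value is a minimum over `x` of functions affine in the row shift, hence concave in it. -/
theorem gameValue_secondDiff_nonneg [Nonempty ι] [Nonempty κ] [DecidableEq ι] (A : Matrix ι κ ℝ)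
    (h : ℝ) (i : ι) :
    gameValue (A + h • rowOnes κ i) + gameValue (A + (-h) • rowOnes κ i) ≤ 2 * gameValue A := by
  obtain ⟨x, hx, hxA⟩ := exists_worst_eq_gameValue A
  have h1 := gameValue_le (A + h • rowOnes κ i) hx
  have h2 := gameValue_le (A + (-h) • rowOnes κ i) hx
  rw [worst_add_smul_rowOnes] at h1 h2
  linarith

/-- If `x i` exceeds `x' i` by `η`, use `x'` when row `i` is raised and `x` when it is lowered. This
saves `h * η` in total and costs twice the tolerance `h * η / 4`. -/
theorem exists_secondDiff_of_not_isRobust [Nonempty ι] [Nonempty κ] [DecidableEq ι]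
    {A : Matrix ι κ ℝ} {η h : ℝ} (hh : 0 ≤ h) (hA : ¬ IsRobust A η (h * η / 4)) :
    ∃ i, h * η / 2 ≤ 2 * gameValue A - gameValue (A + h • rowOnes κ i)
      - gameValue (A + (-h) • rowOnes κ i) := by
  simp only [IsRobust, not_forall, not_lt] at hA
  obtain ⟨x, x', hx, hx', i, hi⟩ := hA
  refine ⟨i, ?_⟩
  have h1 := gameValue_le (A + h • rowOnes κ i) hx'.1
  have h2 := gameValue_le (A + (-h) • rowOnes κ i) hx.1
  rw [worst_add_smul_rowOnes] at h1 h2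
  nlinarith [hx.2, hx'.2]

theorem gameValue_add_smul_rowOnes_mem [Nonempty ι] [Nonempty κ] [DecidableEq ι]
    (A : Matrix ι κ ℝ) {h : ℝ} (hh : 0 ≤ h) (i : ι) :
    gameValue (A + h • rowOnes κ i) - gameValue A ∈ Set.Icc 0 h := by
  constructor
  · have : gameValue A ≤ gameValue (A + h • rowOnes κ i) + 0 := gameValue_le_add fun i' j => by
      simp only [rowOnes, Matrix.add_apply, Matrix.smul_apply, of_apply, smul_eq_mul]
      split_ifs <;> simp [hh]
    linarith
  · have : gameValue (A + h • rowOnes κ i) ≤ gameValue A + h := gameValue_le_add fun i' j => by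
      simp only [rowOnes, Matrix.add_apply, Matrix.smul_apply, of_apply, smul_eq_mul]
      split_ifs <;> simp [hh]
    linarith

theorem abs_vecMul_le {ι κ : Type*} [Fintype ι] {A : Matrix ι κ ℝ} {M η : ℝ} (hM : ∀ i j, |A i j| ≤ M) {u : ι → ℝ}
    (hu : ∀ i, |u i| ≤ η) (j : κ) : |(u ᵥ* A) j| ≤ Fintype.card ι * η * M := by
  calc |(u ᵥ* A) j| ≤ ∑ i, |u i * A i j| := abs_sum_le_sum_abs _ _
    _ ≤ ∑ _i : ι, η * M := sum_le_sum fun i _ => by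
        rw [abs_mul]
        exact mul_le_mul (hu i) (hM i j) (abs_nonneg _) ((abs_nonneg _).trans (hu i))
    _ = _ := by simp [mul_assoc]

theorem vecMul_le_of_mem {ι κ : Type*} [Fintype ι] {A : Matrix ι κ ℝ} {M : ℝ} (hM : ∀ i j, A i j ≤ M) {x : ι → ℝ}
    (hx : x ∈ stdSimplex ℝ ι) (j : κ) : (x ᵥ* A) j ≤ M := by
  calc (x ᵥ* A) j ≤ ∑ i, x i * M := sum_le_sum fun i _ => mul_le_mul_of_nonneg_left (hM i j) (hx.1 i)
    _ = M := by rw [← sum_mul, hx.2, one_mul]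

theorem IsRobust.abs_sub_lt [Nonempty κ] {A : Matrix ι κ ℝ} {η τ : ℝ} (hA : IsRobust A η τ)
    {x x' : ι → ℝ} (hx : IsNearOpt A τ x) (hx' : IsNearOpt A τ x') (i : ι) : |x i - x' i| < η :=
  abs_lt.2 ⟨by linarith [hA x' x hx' hx i], hA x x' hx hx' i⟩

/-- If optimal strategies are locally stable, tight constraints are well separated from slack
ones, and positive weights are bounded below, then the worst case grows linearly away from the
optimum: a point violating this could be pushed along the ray from `x₀` to distance `η`. -/
theorem linear_growth [Nonempty ι] [Nonempty κ] {A : Matrix ι κ ℝ} {x₀ : ι → ℝ}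
    {η κ₀ τ α β M : ℝ}
    (hx₀ : x₀ ∈ stdSimplex ℝ ι) (hopt : worst A x₀ = gameValue A) (hrob : IsRobust A η τ)
    (hη : 0 < η) (hκ : 0 ≤ κ₀) (hM : ∀ i j, |A i j| ≤ M)
    (hpos : ∀ i, x₀ i = 0 ∨ α ≤ x₀ i)
    (hslack : ∀ j, (x₀ ᵥ* A) j = gameValue A ∨ (x₀ ᵥ* A) j ≤ gameValue A - β)
    (hηα : η ≤ α) (hηβ : Fintype.card ι * η * M ≤ β) (hκτ : κ₀ * η ≤ τ)
    {x : ι → ℝ} (hx : x ∈ stdSimplex ℝ ι) (i : ι) :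
    κ₀ * |x i - x₀ i| ≤ worst A x - gameValue A := by
  obtain ⟨i₀, -, hi₀⟩ := exists_max_image univ (fun i => |x i - x₀ i|) univ_nonempty
  set d := |x i₀ - x₀ i₀| with hd
  have hle : ∀ i, |x i - x₀ i| ≤ d := fun i => hi₀ i (mem_univ i)
  refine le_trans (mul_le_mul_of_nonneg_left (hle i) hκ) ?_
  by_contra! hlt
  have hd0 : 0 < d := by
    rcases (abs_nonneg (x i₀ - x₀ i₀)).lt_or_eq with h | h
    · exact h
    · rw [hd, ← h] at hlt
      linarith [gameValue_le A hx]
  -- The displacement is rescaled to sup-norm exactly `η`, where the strict inequality in `IsRobust`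
  -- fails.
  set r := η / d with hr
  have hr0 : 0 < r := by positivity
  have hrd : r * d = η := by rw [hr]; field_simp
  set u : ι → ℝ := r • (x - x₀) with hu
  have hui : ∀ i, |u i| ≤ η := fun i => by
    rw [hu, Pi.smul_apply, smul_eq_mul, abs_mul, abs_of_pos hr0, ← hrd]
    exact mul_le_mul_of_nonneg_left (hle i) hr0.le
  have huj : ∀ j, (u ᵥ* A) j = r * ((x ᵥ* A) j - (x₀ ᵥ* A) j) := fun j => by
    simp [hu, smul_vecMul, sub_vecMul]
  -- Coordinates vanishing at `x₀` can only increase along the ray; the others start at `α ≥ η` or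
  -- more.
  have hmem : x₀ + u ∈ stdSimplex ℝ ι := by
    refine ⟨fun k => ?_, ?_⟩
    · rcases hpos k with h | h
      · have := hx.1 k
        simp only [hu, Pi.add_apply, Pi.smul_apply, Pi.sub_apply, h, smul_eq_mul]
        simp; positivity
      · have := (abs_le.1 (hui k)).1
        simp only [Pi.add_apply]; linarith
    · simp [hu, sum_add_distrib, ← mul_sum, hx.2, hx₀.2]
  have hτ : r * (κ₀ * d) ≤ τ := by
    calc r * (κ₀ * d) = κ₀ * (r * d) := by ring
      _ ≤ τ := by rw [hrd]; exact hκτ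
  have hτ0 : 0 ≤ τ := le_trans (by positivity) hτ
  have hnear : IsNearOpt A τ (x₀ + u) := ⟨hmem, worst_le_iff.2 fun j => by
    rw [add_vecMul, Pi.add_apply]
    rcases hslack j with h | h
    · rw [huj, h]
      have : r * ((x ᵥ* A) j - gameValue A) ≤ r * (κ₀ * d) :=
        mul_le_mul_of_nonneg_left (by linarith [le_worst A x j]) hr0.le
      linarith
    · have := (abs_le.1 (abs_vecMul_le hM hui j)).2
      linarith⟩
  have hnear₀ : IsNearOpt A τ x₀ := ⟨hx₀, by linarith⟩
  have := hrob.abs_sub_lt hnear hnear₀ i₀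
  rw [Pi.add_apply, add_sub_cancel_left, hu, Pi.smul_apply, smul_eq_mul, abs_mul, abs_of_pos hr0,
    Pi.sub_apply, ← hd, hrd] at this
  exact lt_irrefl _ this

/-- If raising column `j` by `ε` leaves it useless, an optimal strategy of the raised game has slack
`ε` there, and robustness passes half of it on to `x₀`. A needed column must be tight, since
otherwise mixing in an optimal strategy of the game without `j` would beat the value. -/
theorem slack_of_colDichotomy [Nonempty ι] [Nonempty κ] [DecidableEq κ] {A : Matrix ι κ ℝ}
    {ε η τ M : ℝ} (hε : 0 < ε) (hτ : 0 ≤ τ) (hA : ColDichotomy A ε) (hrob : IsRobust A η τ)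
    (hM : ∀ i j, |A i j| ≤ M) (hηε : Fintype.card ι * η * M ≤ ε / 2) {x₀ : ι → ℝ}
    (hx₀ : x₀ ∈ stdSimplex ℝ ι) (hopt : worst A x₀ = gameValue A) (j : κ) :
    (x₀ ᵥ* A) j = gameValue A ∨ (x₀ ᵥ* A) j ≤ gameValue A - ε / 2 := by
  by_cases hne : Nonempty {k // k ≠ j}
  · rcases hA j hne with h | h
    · right
      obtain ⟨x, hx, hxA⟩ := exists_worst_eq_gameValue (A + ε • colOnes ι j)
      have hdel := gameValue_deleteCol_le A j
      have hcol : ∀ k, (x ᵥ* A) k + (if k = j then ε else 0) ≤ gameValue A := fun k => by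
        rw [← vecMul_add_smul_colOnes A ε j hx]
        exact (le_worst _ x k).trans (by linarith)
      have hnear : IsNearOpt A τ x := ⟨hx, worst_le_iff.2 fun k => by
        have := hcol k
        split_ifs at this <;> linarith⟩
      have hnear₀ : IsNearOpt A τ x₀ := ⟨hx₀, by linarith⟩
      have hd := (abs_le.1 (abs_vecMul_le hM (u := x₀ - x)
        (fun i => (hrob.abs_sub_lt hnear₀ hnear i).le) j)).2
      rw [sub_vecMul, Pi.sub_apply] at hd
      have := hcol j
      rw [if_pos rfl] at this
      linarith
    · left
      have hmono : gameValue (A + (-ε) • colOnes ι j) ≤ gameValue A + 0 :=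
        gameValue_le_add fun i k => by
          simp only [colOnes, Matrix.add_apply, Matrix.smul_apply, of_apply, smul_eq_mul]
          split_ifs <;> simp [hε.le]
      obtain ⟨x, hx, hxA⟩ := exists_worst_eq_gameValue (deleteCol A j)
      by_contra hne'
      have hlt : (x₀ ᵥ* A) j < gameValue A :=
        lt_of_le_of_ne (hopt ▸ le_worst A x₀ j) hne'
      -- a small move from `x₀` towards `x` improves every column
      set s := gameValue A - (x₀ ᵥ* A) j with hs
      have hs0 : 0 < s := by linarith
      set b := |(x ᵥ* A) j - (x₀ ᵥ* A) j| with hb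
      have hb0 : 0 ≤ b := abs_nonneg _
      -- With this weight, column `j` rises by at most `t * b ≤ s / 2`, less than its slack `s`.
      set t := s / (2 * (s + b)) with ht
      have ht0 : 0 < t := by positivity
      have htb : t * (s + b) = s / 2 := by rw [ht]; field_simp
      have ht1 : t ≤ 1 := by
        rw [ht, div_le_one (by positivity)]; linarith
      have hmem : (1 - t) • x₀ + t • x ∈ stdSimplex ℝ ι :=
        convex_stdSimplex ℝ ι hx₀ hx (by linarith) ht0.le (by ring)
      obtain ⟨k, hk⟩ := exists_worst_eq A ((1 - t) • x₀ + t • x)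
      have hge := gameValue_le A hmem
      rw [hk] at hge
      simp only [add_vecMul, smul_vecMul, Pi.add_apply, Pi.smul_apply, smul_eq_mul] at hge
      by_cases hkj : k = j
      · subst hkj
        have h3 : t * ((x ᵥ* A) k - (x₀ ᵥ* A) k) ≤ t * b :=
          mul_le_mul_of_nonneg_left (le_abs_self _) ht0.le
        nlinarith
      · have h1 : (x₀ ᵥ* A) k ≤ gameValue A := hopt ▸ le_worst A x₀ k
        have h2 : (x ᵥ* A) k ≤ gameValue (deleteCol A j) :=
          hxA ▸ le_worst (deleteCol A j) x ⟨k, hkj⟩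
        nlinarith
  · left
    have hall : ∀ k, k = j := fun k => by
      by_contra hk; exact hne ⟨⟨k, hk⟩⟩
    obtain ⟨k, hk⟩ := exists_worst_eq A x₀
    rw [← hopt, hk, hall k]

/-- The gain from a column that the maximizer needs. -/
theorem gameValue_deleteCol_add_le [Nonempty ι] [Nonempty κ] [DecidableEq κ] {A : Matrix ι κ ℝ}
    {ε η τ M : ℝ} {j : κ} [Nonempty {k // k ≠ j}] (hτ : 0 ≤ τ)
    (h : gameValue (deleteCol A j) < gameValue (A + (-ε) • colOnes ι j))
    (hrob : IsRobust (deleteCol A j) η τ) (hM : ∀ i j, |A i j| ≤ M)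
    (hηε : Fintype.card ι * η * M ≤ ε / 2) (hτε : τ ≤ ε / 2) :
    gameValue (deleteCol A j) + τ ≤ gameValue A := by
  by_contra! hlt
  obtain ⟨x, hx, hxA⟩ := exists_worst_eq_gameValue A
  obtain ⟨x₀, hx₀, hopt⟩ := exists_worst_eq_gameValue (deleteCol A j)
  have hnear : IsNearOpt (deleteCol A j) τ x :=
    ⟨hx, (worst_deleteCol_le A j x).trans (by linarith)⟩
  have hnear₀ : IsNearOpt (deleteCol A j) τ x₀ := ⟨hx₀, by linarith⟩
  -- In the game with column `j` lowered, `x₀` still concedes more than the deleted value, and only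
  -- column `j` can be responsible.
  have hj : gameValue (deleteCol A j) < (x₀ ᵥ* A) j - ε := by
    obtain ⟨k, hk⟩ := exists_worst_eq (A + (-ε) • colOnes ι j) x₀
    have h1 := gameValue_le (A + (-ε) • colOnes ι j) hx₀
    rw [hk, vecMul_add_smul_colOnes A _ j hx₀] at h1
    by_cases hkj : k = j
    · rw [if_pos hkj, hkj] at h1; linarith
    · rw [if_neg hkj] at h1
      have : (x₀ ᵥ* A) k ≤ gameValue (deleteCol A j) :=
        hopt ▸ le_worst (deleteCol A j) x₀ ⟨k, hkj⟩
      linarith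
  have hd := (abs_le.1 (abs_vecMul_le hM (u := x₀ - x)
    (fun i => (hrob.abs_sub_lt hnear₀ hnear i).le) j)).2
  rw [sub_vecMul, Pi.sub_apply] at hd
  have := le_worst A x j
  linarith

/-- If giving up row `i` costs the minimizer `γ`, then every optimal strategy uses row `i` with a
weight bounded below. -/
theorem weight_ge_of_deleteRow [DecidableEq ι] [Nonempty ι] [Nonempty κ] {A : Matrix ι κ ℝ}
    {γ M : ℝ} {i : ι} [Nonempty {k // k ≠ i}] (hγ : 0 < γ) (hγM : γ ≤ M)
    (h : gameValue (deleteCol (negTranspose A) i) + γ ≤ gameValue (negTranspose A))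
    (hM : ∀ i j, |A i j| ≤ M) {x₀ : ι → ℝ}
    (hx₀ : x₀ ∈ stdSimplex ℝ ι) (hopt : worst A x₀ = gameValue A) :
    γ / (3 * M) ≤ x₀ i := by
  set B : Matrix {k // k ≠ i} κ ℝ := negTranspose (deleteCol (negTranspose A) i) with hB
  have hBA : ∀ k j, B k j = A k j := fun k j => by simp [hB, deleteCol]
  have hval : gameValue A + γ ≤ gameValue B := by
    rw [hB, gameValue_negTranspose]
    rw [gameValue_negTranspose A] at h
    linarith
  have hsplit : ∀ f : ι → ℝ, ∑ k, f k = f i + ∑ k : {k // k ≠ i}, f k := fun f => by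
    rw [Fintype.sum_eq_add_sum_subtype_ne f i]
  have hVM : gameValue A ≤ M := (gameValue_le A hx₀).trans <|
    worst_le_iff.2 fun j => vecMul_le_of_mem (fun i j => (abs_le.1 (hM i j)).2) hx₀ j
  have hM0 : 0 < M := by linarith
  have hxi := hx₀.1 i
  rw [div_le_iff₀ (by positivity)]
  have hsum := hx₀.2
  rw [hsplit] at hsum
  have hxi1 : x₀ i ≤ 1 := by
    have : 0 ≤ ∑ k : {k // k ≠ i}, x₀ k := sum_nonneg fun k _ => hx₀.1 k
    linarith
  rcases hxi1.lt_or_eq with hlt | heq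
  · have hpos : 0 < 1 - x₀ i := by linarith
    -- Dropping row `i` and renormalizing must cost at least `γ`, which gives `γ ≤ x₀ i * (gameValue
    -- A + γ + M) ≤ 3 * M * x₀ i`.
    set x : {k // k ≠ i} → ℝ := fun k => (1 - x₀ i)⁻¹ * x₀ k with hx
    have hxmem : x ∈ stdSimplex ℝ {k // k ≠ i} := by
      refine ⟨fun k => mul_nonneg (by positivity) (hx₀.1 k), ?_⟩
      rw [← mul_sum, show ∑ k : {k // k ≠ i}, x₀ k = 1 - x₀ i by linarith]
      field_simp
    obtain ⟨j, hj⟩ := exists_worst_eq B x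
    have h1 := gameValue_le B hxmem
    rw [hj] at h1
    have h2 : (1 - x₀ i) * (x ᵥ* B) j = (x₀ ᵥ* A) j - x₀ i * A i j := by
      have e1 : (x₀ ᵥ* A) j = x₀ i * A i j + ∑ k : {k // k ≠ i}, x₀ k * A k j :=
        hsplit fun k => x₀ k * A k j
      rw [e1, add_sub_cancel_left]
      simp only [vecMul, dotProduct, mul_sum]
      refine sum_congr rfl fun k _ => ?_
      rw [hBA, hx]
      field_simp
    have h3 : (x₀ ᵥ* A) j ≤ gameValue A := hopt ▸ le_worst A x₀ j
    have h4 := (abs_le.1 (hM i j)).1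
    have h5 : (1 - x₀ i) * (gameValue A + γ) ≤ (1 - x₀ i) * (x ᵥ* B) j :=
      mul_le_mul_of_nonneg_left (by linarith) hpos.le
    nlinarith
  · rw [heq]; linarith

/-- Rows are columns of the dual game. If row `i` stays useless when made cheaper by `ε`, the value
does not drop, so `ε * x₀ i ≤ 0`; if it is needed, its removal costs at least `τ`. -/
theorem weight_of_rowDichotomy [Nonempty ι] [Nonempty κ] [DecidableEq ι] {A : Matrix ι κ ℝ}
    {ε η τ M : ℝ} (hε : 0 < ε) (hτ : 0 < τ) (hτM : τ ≤ M)
    (hA : ColDichotomy (negTranspose A) ε)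
    (hrob : ∀ i : ι, ∀ _ : Nonempty {k // k ≠ i}, IsRobust (deleteCol (negTranspose A) i) η τ)
    (hM : ∀ i j, |A i j| ≤ M)
    (hηε : Fintype.card κ * η * M ≤ ε / 2) (hτε : τ ≤ ε / 2) {x₀ : ι → ℝ}
    (hx₀ : x₀ ∈ stdSimplex ℝ ι) (hopt : worst A x₀ = gameValue A) (i : ι) :
    x₀ i = 0 ∨ τ / (3 * M) ≤ x₀ i := by
  by_cases hne : Nonempty {k // k ≠ i}
  · rcases hA i hne with h | h
    · left
      have h1 := gameValue_le (A + (-ε) • rowOnes κ i) hx₀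
      rw [worst_add_smul_rowOnes] at h1
      have h2 := gameValue_negTranspose (A + (-ε) • rowOnes κ i)
      rw [negTranspose_add_smul_rowOnes, neg_neg] at h2
      have h3 := gameValue_deleteCol_le (negTranspose A) i
      rw [gameValue_negTranspose A] at h3
      have := hx₀.1 i
      nlinarith
    · right
      exact weight_ge_of_deleteRow hτ hτM
        (gameValue_deleteCol_add_le hτ.le h (hrob i hne) (fun i j => by simpa using hM j i) hηε hτε)
        hM hx₀ hopt
  · right
    have hall : ∀ k, k = i := fun k => by
      by_contra hk; exact hne ⟨⟨k, hk⟩⟩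
    have : x₀ i = 1 := by
      rw [← hx₀.2, Fintype.sum_eq_single i fun k hk => absurd (hall k) hk]
    rw [this, div_le_one (by linarith)]
    linarith

end Perturbations

/-! ### Gaussian measures under small translations. -/

section Shift

open Finset
open scoped NNReal ENNReal

/-- The density of a Gaussian shifted by `c` with respect to the centered one. -/
noncomputable def shiftDensity (v : ℝ≥0) (c x : ℝ) : ℝ := Real.exp (c / v * x - c ^ 2 / (2 * v))

theorem continuous_shiftDensity (v : ℝ≥0) (c : ℝ) : Continuous (shiftDensity v c) := by
  unfold shiftDensity; fun_prop

theorem shiftDensity_pos (v : ℝ≥0) (c x : ℝ) : 0 < shiftDensity v c x := Real.exp_pos _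

theorem integrable_shiftDensity (v : ℝ≥0) (c : ℝ) :
    Integrable (shiftDensity v c) (gaussianReal 0 v) := by
  unfold shiftDensity
  simp_rw [sub_eq_add_neg, Real.exp_add]
  exact (integrable_exp_mul_gaussianReal _).mul_const _

theorem shiftDensity_sq (v : ℝ≥0) (c x : ℝ) :
    shiftDensity v c x ^ 2 = Real.exp (2 * c / v * x) * Real.exp (-(c ^ 2 / v)) := by
  rw [shiftDensity, ← Real.exp_nat_mul, ← Real.exp_add]
  congr 1; push_cast; ring

theorem integrable_shiftDensity_sq (v : ℝ≥0) (c : ℝ) :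
    Integrable (fun x => shiftDensity v c x ^ 2) (gaussianReal 0 v) := by
  simp_rw [shiftDensity_sq]
  exact (integrable_exp_mul_gaussianReal _).mul_const _

theorem integral_shiftDensity_sq {v : ℝ≥0} (hv : v ≠ 0) (c : ℝ) :
    ∫ x, shiftDensity v c x ^ 2 ∂(gaussianReal 0 v) = Real.exp (c ^ 2 / v) := by
  have hv' : (v : ℝ) ≠ 0 := by exact_mod_cast hv
  have h := congrFun (mgf_fun_id_gaussianReal (μ := 0) (v := v)) (2 * c / v)
  rw [mgf] at h
  simp_rw [shiftDensity_sq, integral_mul_const]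
  rw [h, ← Real.exp_add]
  congr 1; field_simp; ring

theorem gaussianReal_eq_withDensity {v : ℝ≥0} (hv : v ≠ 0) (c : ℝ) :
    gaussianReal c v =
      (gaussianReal 0 v).withDensity fun x => ENNReal.ofReal (shiftDensity v c x) := by
  have hv' : (v : ℝ) ≠ 0 := by exact_mod_cast hv
  rw [gaussianReal_of_var_ne_zero _ hv, gaussianReal_of_var_ne_zero _ hv,
    ← withDensity_mul _ (measurable_gaussianPDF 0 v)
      (continuous_shiftDensity v c).measurable.ennreal_ofReal]
  congr 1
  ext x
  rw [Pi.mul_apply, gaussianPDF, gaussianPDF, ← ENNReal.ofReal_mul (gaussianPDFReal_nonneg _ _ _)]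
  congr 1
  simp only [gaussianPDFReal, shiftDensity]
  rw [mul_assoc (Real.sqrt _)⁻¹, ← Real.exp_add]
  congr 2; field_simp; ring

variable {Ω : Type*} [Fintype Ω]

/-- Independent centered Gaussians of variance `v`. -/
noncomputable def gaussianVec (Ω : Type*) [Fintype Ω] (v : ℝ≥0) : Measure (Ω → ℝ) :=
  Measure.pi fun _ => gaussianReal 0 v

instance (v : ℝ≥0) : IsProbabilityMeasure (gaussianVec Ω v) := by
  unfold gaussianVec; infer_instance

theorem map_add_gaussianVec {v : ℝ≥0} (hv : v ≠ 0) (c : Ω → ℝ) :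
    (gaussianVec Ω v).map (fun x => x + c) =
      (gaussianVec Ω v).withDensity
        fun x => ENNReal.ofReal (∏ k, shiftDensity v (c k) (x k)) := by
  have h1 : (gaussianVec Ω v).map (fun x => x + c) = Measure.pi fun k => gaussianReal (c k) v := by
    have := Measure.pi_map_pi (μ := fun _ : Ω => gaussianReal 0 v) (f := fun k x => x + c k)
      (fun k => by fun_prop)
    simp_rw [gaussianReal_map_add_const, zero_add] at this
    exact this
  rw [h1]
  refine Measure.pi_eq fun s hs => ?_
  rw [withDensity_apply _ (MeasurableSet.univ_pi hs), gaussianVec, Measure.restrict_pi_pi]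
  have hint : ∀ k, Integrable (shiftDensity v (c k)) ((gaussianReal 0 v).restrict (s k)) :=
    fun k => (integrable_shiftDensity v (c k)).restrict
  rw [← ofReal_integral_eq_lintegral_ofReal (Integrable.fintype_prod hint)
    (Filter.Eventually.of_forall fun x => prod_nonneg fun k _ => (shiftDensity_pos _ _ _).le),
    integral_fintype_prod_eq_prod (fun k => shiftDensity v (c k)),
    ENNReal.ofReal_prod_of_nonneg fun k _ => integral_nonneg fun x => (shiftDensity_pos _ _ _).le]
  refine prod_congr rfl fun k _ => ?_
  rw [gaussianReal_eq_withDensity hv (c k), withDensity_apply _ (hs k),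
    ofReal_integral_eq_lintegral_ofReal (hint k)
      (Filter.Eventually.of_forall fun x => (shiftDensity_pos _ _ _).le)]

/-- A shift that is small compared to the standard deviation hardly changes the expectation of a
bounded function. -/
theorem abs_integral_shift_sub_le {v : ℝ≥0} (hv : v ≠ 0) {c : Ω → ℝ} {q : ℝ} (hq : 0 < q)
    (hq1 : q ≤ 1) (hc : ∑ k, c k ^ 2 ≤ q ^ 2 * v) {f : (Ω → ℝ) → ℝ} (hf : Measurable f) {b : ℝ}
    (hfb : ∀ x, |f x| ≤ b) :
    |∫ x, f (x + c) ∂(gaussianVec Ω v) - ∫ x, f x ∂(gaussianVec Ω v)| ≤ 2 * q * b := by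
  have hv' : (0 : ℝ) < v := by exact_mod_cast pos_iff_ne_zero.2 hv
  set ρ : (Ω → ℝ) → ℝ := fun x => ∏ k, shiftDensity v (c k) (x k) with hρ
  have hρ0 : ∀ x, 0 ≤ ρ x := fun x => prod_nonneg fun k _ => (shiftDensity_pos _ _ _).le
  have hρm : Measurable ρ := by
    refine Continuous.measurable (continuous_finsetProd _ fun k _ => ?_)
    exact (continuous_shiftDensity v (c k)).comp (continuous_apply k)
  have hmap := map_add_gaussianVec hv c
  have hρi : Integrable ρ (gaussianVec Ω v) :=
    Integrable.fintype_prod fun k => integrable_shiftDensity v (c k)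
  have hρ2i : Integrable (fun x => ρ x ^ 2) (gaussianVec Ω v) := by
    simp_rw [hρ, ← prod_pow]
    exact Integrable.fintype_prod fun k => integrable_shiftDensity_sq v (c k)
  have hfm : ∀ {g : (Ω → ℝ) → ℝ}, Integrable g (gaussianVec Ω v) →
      Integrable (fun x => g x * f x) (gaussianVec Ω v) := fun hg =>
    hg.mul_bdd hf.aestronglyMeasurable (Filter.Eventually.of_forall hfb)
  have hshift : ∫ x, f (x + c) ∂(gaussianVec Ω v) = ∫ x, ρ x * f x ∂(gaussianVec Ω v) := by
    rw [← integral_map (φ := fun x => x + c) (by fun_prop) hf.aestronglyMeasurable, hmap,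
      integral_withDensity_eq_integral_toReal_smul hρm.ennreal_ofReal (by simp)]
    refine integral_congr_ae (Filter.Eventually.of_forall fun x => ?_)
    simp only [smul_eq_mul]
    rw [ENNReal.toReal_ofReal (hρ0 x)]
  have hone : ∫ x, ρ x ∂(gaussianVec Ω v) = 1 := by
    have hu : ((gaussianVec Ω v).map (fun x => x + c)) Set.univ = 1 := by
      rw [Measure.map_apply (by fun_prop) MeasurableSet.univ]; simp
    rw [hmap, withDensity_apply _ MeasurableSet.univ, Measure.restrict_univ,
      ← ofReal_integral_eq_lintegral_ofReal hρi (Filter.Eventually.of_forall hρ0)] at hu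
    have := congrArg ENNReal.toReal hu
    rwa [ENNReal.toReal_ofReal (integral_nonneg hρ0), ENNReal.toReal_one] at this
  -- The second moment factors over coordinates into `exp (∑ c k ^ 2 / v)`.
  have hsq : ∫ x, ρ x ^ 2 ∂(gaussianVec Ω v) ≤ 1 + 2 * q ^ 2 := by
    simp_rw [hρ, ← prod_pow]
    rw [gaussianVec, integral_fintype_prod_eq_prod (fun k x => shiftDensity v (c k) x ^ 2)]
    simp_rw [integral_shiftDensity_sq hv]
    rw [← Real.exp_sum, ← sum_div]
    have h1 : (∑ k, c k ^ 2) / v ≤ q ^ 2 := by rwa [div_le_iff₀ hv']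
    have h2 := Real.abs_exp_sub_one_le (x := q ^ 2) (by rw [abs_of_nonneg (by positivity)]; nlinarith)
    rw [abs_of_nonneg (a := q ^ 2) (by positivity)] at h2
    have h3 := Real.exp_le_exp.2 h1
    linarith [le_abs_self (Real.exp (q ^ 2) - 1)]
  have hb : 0 ≤ b := (abs_nonneg _).trans (hfb 0)
  have hfi : Integrable f (gaussianVec Ω v) := by
    simpa using hfm (integrable_const (1 : ℝ))
  -- AM-GM, `|ρ - 1| ≤ q / 2 + (ρ - 1) ^ 2 / (2 * q)`, replaces Cauchy–Schwarz for bounding the mean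
  -- of `|ρ - 1|`.
  have hpt : ∀ x, |ρ x * f x - f x| ≤ b * (q / 2 + (ρ x ^ 2 - 2 * ρ x + 1) * (2 * q)⁻¹) := by
    intro x
    have e : ρ x * f x - f x = f x * (ρ x - 1) := by ring
    rw [e, abs_mul]
    refine mul_le_mul (hfb x) ?_ (abs_nonneg _) hb
    have e2 : q / 2 + (ρ x ^ 2 - 2 * ρ x + 1) * (2 * q)⁻¹ - |ρ x - 1| =
        (|ρ x - 1| - q) ^ 2 * (2 * q)⁻¹ := by
      field_simp
      have := sq_abs (ρ x - 1)
      linear_combination -this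
    have : 0 ≤ (|ρ x - 1| - q) ^ 2 * (2 * q)⁻¹ := by positivity
    linarith
  have hbi : Integrable (fun x => ρ x ^ 2 - 2 * ρ x + 1) (gaussianVec Ω v) :=
    (hρ2i.sub (hρi.const_mul 2)).add (integrable_const 1)
  have hb2 : ∫ x, (ρ x ^ 2 - 2 * ρ x + 1) ∂(gaussianVec Ω v) =
      ∫ x, ρ x ^ 2 ∂(gaussianVec Ω v) - 2 * 1 + 1 := by
    rw [integral_add (f := fun x => ρ x ^ 2 - 2 * ρ x) (hρ2i.sub (hρi.const_mul 2))
      (integrable_const 1), integral_sub hρ2i (hρi.const_mul 2), integral_const_mul, hone]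
    simp
  rw [hshift, ← integral_sub (hfm hρi) hfi]
  calc |∫ x, (ρ x * f x - f x) ∂(gaussianVec Ω v)|
      ≤ ∫ x, |ρ x * f x - f x| ∂(gaussianVec Ω v) := abs_integral_le_integral_abs
    _ ≤ ∫ x, b * (q / 2 + (ρ x ^ 2 - 2 * ρ x + 1) * (2 * q)⁻¹) ∂(gaussianVec Ω v) :=
        integral_mono ((hfm hρi).sub hfi).abs
          (((integrable_const _).add (hbi.mul_const _)).const_mul b) hpt
    _ = b * (q / 2 + (∫ x, ρ x ^ 2 ∂(gaussianVec Ω v) - 2 * 1 + 1) * (2 * q)⁻¹) := by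
        rw [integral_const_mul, integral_add (integrable_const _) (hbi.mul_const _),
          integral_mul_const, hb2]
        simp
    _ ≤ b * (q / 2 + 2 * q ^ 2 * (2 * q)⁻¹) := by
        refine mul_le_mul_of_nonneg_left ?_ hb
        have : (0 : ℝ) ≤ (2 * q)⁻¹ := by positivity
        nlinarith
    _ ≤ 2 * q * b := by
        have : 2 * q ^ 2 * (2 * q)⁻¹ = q := by field_simp
        rw [this]; nlinarith [mul_nonneg hb hq.le]

end Shift

/-! ### Probabilities of the bad events. -/

section Events

open Finset Matrix
open scoped NNReal ENNReal

variable {Ω ι κ : Type*} [Fintype Ω]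

/-- A random game in which every row and every column can be shifted by moving the noise in a
direction of square norm at most `N`. -/
structure IsNoisy [DecidableEq ι] [DecidableEq κ] (A : (Ω → ℝ) → Matrix ι κ ℝ) (N : ℝ) : Prop where
  continuous : Continuous A
  row : ∀ i, ∃ c : Ω → ℝ, ∑ k, c k ^ 2 ≤ N ∧ ∀ (G : Ω → ℝ) (h : ℝ), A (G + h • c) = A G + h • rowOnes κ i
  col : ∀ j, ∃ c : Ω → ℝ, ∑ k, c k ^ 2 ≤ N ∧ ∀ (G : Ω → ℝ) (h : ℝ), A (G + h • c) = A G + h • colOnes ι j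

theorem IsNoisy.negTranspose [DecidableEq ι] [DecidableEq κ] {A : (Ω → ℝ) → Matrix ι κ ℝ} {N : ℝ}
    (hA : IsNoisy A N) : IsNoisy (fun G => negTranspose (A G)) N where
  continuous := hA.continuous.matrix_transpose.neg
  row j := by
    obtain ⟨c, hc, h⟩ := hA.col j
    refine ⟨-c, by simpa using hc, fun G t => ?_⟩
    rw [smul_neg, ← neg_smul, h, negTranspose_add_smul_colOnes, neg_neg]
  col i := by
    obtain ⟨c, hc, h⟩ := hA.row i
    refine ⟨-c, by simpa using hc, fun G t => ?_⟩
    rw [smul_neg, ← neg_smul, h, negTranspose_add_smul_rowOnes, neg_neg]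

theorem IsNoisy.deleteCol [DecidableEq ι] [DecidableEq κ] {A : (Ω → ℝ) → Matrix ι κ ℝ} {N : ℝ}
    (hA : IsNoisy A N) (j : κ) : IsNoisy (fun G => deleteCol (A G) j) N where
  continuous := hA.continuous.matrix_submatrix _ _
  row i := by
    obtain ⟨c, hc, h⟩ := hA.row i
    exact ⟨c, hc, fun G t => by rw [h, deleteCol_add_smul_rowOnes]⟩
  col k := by
    obtain ⟨c, hc, h⟩ := hA.col k
    refine ⟨c, hc, fun G t => ?_⟩
    rw [h]
    ext i l
    simp [ZeroSumGame.deleteCol, colOnes, Subtype.ext_iff]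

theorem measure_exists_le {α : Type*} {mα : MeasurableSpace α} (μ : Measure α) {β : Type*}
    [Fintype β] {P : β → α → Prop} {p B : ℝ} (hp : 0 ≤ p) (hB : Fintype.card β ≤ B)
    (h : ∀ b, μ {a | P b a} ≤ ENNReal.ofReal p) :
    μ {a | ∃ b, P b a} ≤ ENNReal.ofReal (B * p) := by
  calc μ {a | ∃ b, P b a} = μ (⋃ b, {a | P b a}) := by
        congr 1; ext; simp
    _ ≤ ∑ b, μ {a | P b a} := measure_iUnion_fintype_le _ _
    _ ≤ ∑ _b : β, ENNReal.ofReal p := sum_le_sum fun b _ => h b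
    _ = ENNReal.ofReal (Fintype.card β * p) := by
        rw [sum_const, nsmul_eq_mul, card_univ, ENNReal.ofReal_mul (by positivity)]; simp
    _ ≤ _ := ENNReal.ofReal_le_ofReal (mul_le_mul_of_nonneg_right hB hp)

theorem measure_exists_abs_ge_le {v : ℝ≥0} {t B : ℝ} (ht : 0 < t) (hB : Fintype.card Ω ≤ B) :
    gaussianVec Ω v {G | ∃ k, t ≤ |G k|} ≤ ENNReal.ofReal (B * (v / t ^ 2)) := by
  refine measure_exists_le _ (by positivity) hB fun k => ?_
  have hpres := measurePreserving_eval (fun _ : Ω => gaussianReal 0 v) k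
  have hcheb := meas_ge_le_variance_div_sq (memLp_id_gaussianReal (μ := 0) (v := v) 2) ht
  rw [variance_id_gaussianReal] at hcheb
  simp only [id, integral_id_gaussianReal, sub_zero] at hcheb
  refine le_trans (le_of_eq ?_) hcheb
  exact hpres.measure_preimage (measurableSet_le measurable_const measurable_abs).nullMeasurableSet

variable [Fintype ι] [Fintype κ] [Nonempty ι] [Nonempty κ] [DecidableEq ι] [DecidableEq κ]

/-- The second difference is `w (G - h • c) - w G` for the one-step increment `w`, which lies in
`[0, h]`. Its mean is therefore at most `2 * q * h`, and in Markov's inequality at level `h * η / 2`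
the factor `h` cancels. -/
theorem measure_secondDiff_le {A : (Ω → ℝ) → Matrix ι κ ℝ} {N : ℝ} (hA : IsNoisy A N) {v : ℝ≥0}
    (hv : v ≠ 0) {h η q : ℝ} (hh : 0 < h) (hη : 0 < η) (hq : 0 < q) (hq1 : q ≤ 1)
    (hN : h ^ 2 * N ≤ q ^ 2 * v) (i : ι) :
    gaussianVec Ω v {G | h * η / 2 ≤ 2 * gameValue (A G) - gameValue (A G + h • rowOnes κ i)
      - gameValue (A G + (-h) • rowOnes κ i)} ≤ ENNReal.ofReal (4 * q / η) := by
  obtain ⟨c, hc, hshift⟩ := hA.row i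
  set w : (Ω → ℝ) → ℝ := fun G => gameValue (A G + h • rowOnes κ i) - gameValue (A G) with hw
  have hwc : Continuous w :=
    (continuous_gameValue.comp (hA.continuous.add continuous_const)).sub
      (continuous_gameValue.comp hA.continuous)
  have hwmem : ∀ G, w G ∈ Set.Icc 0 h := fun G => gameValue_add_smul_rowOnes_mem _ hh.le i
  have hwb : ∀ G, |w G| ≤ h := fun G => abs_le.2 ⟨by linarith [(hwmem G).1], (hwmem G).2⟩
  have hsq : ∑ k, ((-h) • c) k ^ 2 ≤ q ^ 2 * v := by
    calc ∑ k, ((-h) • c) k ^ 2 = h ^ 2 * ∑ k, c k ^ 2 := by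
          simp [mul_sum, mul_pow]
      _ ≤ h ^ 2 * N := mul_le_mul_of_nonneg_left hc (sq_nonneg _)
      _ ≤ _ := hN
  have key := abs_integral_shift_sub_le hv hq hq1 hsq hwc.measurable hwb
  have hws : ∀ G, w (G + (-h) • c) = gameValue (A G) - gameValue (A G + (-h) • rowOnes κ i) := by
    intro G
    simp only [hw, hshift]
    rw [add_assoc, ← add_smul]; simp
  have hdiff : ∀ G, w (G + (-h) • c) - w G = 2 * gameValue (A G)
      - gameValue (A G + h • rowOnes κ i) - gameValue (A G + (-h) • rowOnes κ i) := by
    intro G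
    rw [hws]; simp only [hw]; ring
  have hint : ∀ {g : (Ω → ℝ) → ℝ}, Continuous g → (∀ G, |g G| ≤ h) →
      Integrable g (gaussianVec Ω v) := fun hg hb =>
    Integrable.of_bound hg.aestronglyMeasurable h (Filter.Eventually.of_forall hb)
  have hwsc : Continuous fun G => w (G + (-h) • c) := hwc.comp (by fun_prop)
  have hmarkov := mul_meas_ge_le_integral_of_nonneg (μ := gaussianVec Ω v)
    (f := fun G => w (G + (-h) • c) - w G)
    (Filter.Eventually.of_forall fun G => by
      have := gameValue_secondDiff_nonneg (A G) h i
      change 0 ≤ w (G + (-h) • c) - w G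
      rw [hdiff]; linarith)
    ((hint hwsc fun G => hwb _).sub (hint hwc hwb)) (h * η / 2)
  rw [integral_sub (hint hwsc fun G => hwb _) (hint hwc hwb)] at hmarkov
  simp_rw [← hdiff]
  rw [← ofReal_measureReal]
  refine ENNReal.ofReal_le_ofReal ?_
  rw [le_div_iff₀ hη]
  have h2 := hmarkov.trans ((le_abs_self _).trans key)
  have h3 : h * (Measure.real (gaussianVec Ω v) {G | h * η / 2 ≤ w (G + (-h) • c) - w G} * η)
      ≤ h * (4 * q) := by linarith
  exact le_of_mul_le_mul_left h3 hh

theorem measure_not_isRobust_le {A : (Ω → ℝ) → Matrix ι κ ℝ} {N : ℝ} (hA : IsNoisy A N) {v : ℝ≥0}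
    (hv : v ≠ 0) {h η q B : ℝ} (hh : 0 < h) (hη : 0 < η) (hq : 0 < q) (hq1 : q ≤ 1)
    (hN : h ^ 2 * N ≤ q ^ 2 * v) (hB : Fintype.card ι ≤ B) :
    gaussianVec Ω v {G | ¬ IsRobust (A G) η (h * η / 4)} ≤ ENNReal.ofReal (B * (4 * q / η)) :=
  (measure_mono fun _ hG => exists_secondDiff_of_not_isRobust hh.le hG).trans <|
    measure_exists_le _ (by positivity) hB fun i => measure_secondDiff_le hA hv hh hη hq hq1 hN i

/-- Failure at `j` means that the column is useless when lowered by `ε` but not when raised by `ε`.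
Deleting `j` ignores these shifts, so this is a difference of two nested translates of one event,
each of probability within `2 * q` of the original. -/
theorem measure_not_colDichotomy_le {A : (Ω → ℝ) → Matrix ι κ ℝ} {N : ℝ} (hA : IsNoisy A N)
    {v : ℝ≥0} (hv : v ≠ 0) {ε q B : ℝ} (hε : 0 < ε) (hq : 0 < q) (hq1 : q ≤ 1)
    (hN : ε ^ 2 * N ≤ q ^ 2 * v) (hB : Fintype.card κ ≤ B) :
    gaussianVec Ω v {G | ¬ ColDichotomy (A G) ε} ≤ ENNReal.ofReal (B * (4 * q)) := by
  have hsub : {G | ¬ ColDichotomy (A G) ε} ⊆ {G | ∃ j, ∃ _ : Nonempty {k // k ≠ j},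
      gameValue (deleteCol (A G) j) < gameValue (A G + ε • colOnes ι j) ∧
        gameValue (A G + (-ε) • colOnes ι j) ≤ gameValue (deleteCol (A G) j)} := by
    intro G hG
    simpa only [ColDichotomy, not_forall, not_or, not_le, not_lt, exists_prop] using hG
  refine (measure_mono hsub).trans (measure_exists_le _ (by positivity) hB fun j => ?_)
  by_cases hne : Nonempty {k // k ≠ j}
  swap
  · simp [hne]
  obtain ⟨c, hc, hshift⟩ := hA.col j
  set Q : Set (Ω → ℝ) := {G | gameValue (A G) ≤ gameValue (deleteCol (A G) j)} with hQ
  have hQm : MeasurableSet Q := (isClosed_le (continuous_gameValue.comp hA.continuous)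
    (continuous_gameValue.comp (hA.deleteCol j).continuous)).measurableSet
  set f : (Ω → ℝ) → ℝ := Q.indicator 1 with hf
  have hfm : Measurable f := measurable_one.indicator hQm
  have hf0 : ∀ G, 0 ≤ f G := fun G => Set.indicator_nonneg (fun _ _ => zero_le_one) G
  have hf1 : ∀ G, f G ≤ 1 := fun G => Set.indicator_le_self' (fun _ _ => zero_le_one) G
  have hfb : ∀ G, |f G| ≤ 1 := fun G => by rw [abs_of_nonneg (hf0 G)]; exact hf1 G
  have hsq : ∀ s : ℝ, s ^ 2 = ε ^ 2 → ∑ k, (s • c) k ^ 2 ≤ q ^ 2 * v := fun s hs => by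
    calc ∑ k, (s • c) k ^ 2 = ε ^ 2 * ∑ k, c k ^ 2 := by
          simp [mul_sum, mul_pow, hs]
      _ ≤ ε ^ 2 * N := mul_le_mul_of_nonneg_left hc (sq_nonneg _)
      _ ≤ _ := hN
  have k1 := abs_integral_shift_sub_le hv hq hq1 (hsq ε rfl) hfm hfb
  have k2 := abs_integral_shift_sub_le hv hq hq1 (hsq (-ε) (neg_sq ε)) hfm hfb
  have hmem : ∀ (G : Ω → ℝ) (s : ℝ), G + s • c ∈ Q ↔
      gameValue (A G + s • colOnes ι j) ≤ gameValue (deleteCol (A G) j) := fun G s => by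
    simp only [hQ, Set.mem_ofPred_eq, hshift, deleteCol_add_smul_colOnes]
  have hmono : ∀ G, G + ε • c ∈ Q → G + (-ε) • c ∈ Q := fun G hG => by
    rw [hmem] at hG ⊢
    have : gameValue (A G + (-ε) • colOnes ι j) ≤ gameValue (A G + ε • colOnes ι j) + 0 :=
      gameValue_le_add fun i k => by
        simp only [colOnes, Matrix.add_apply, Matrix.smul_apply, of_apply, smul_eq_mul]
        split_ifs <;> simp; linarith
    linarith
  set S : Set (Ω → ℝ) := {G | ∃ _ : Nonempty {k // k ≠ j},
      gameValue (deleteCol (A G) j) < gameValue (A G + ε • colOnes ι j) ∧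
        gameValue (A G + (-ε) • colOnes ι j) ≤ gameValue (deleteCol (A G) j)} with hS
  have hSeq : S = (fun G => G + (-ε) • c) ⁻¹' Q \ (fun G => G + ε • c) ⁻¹' Q := by
    ext G
    simp only [hS, hne, exists_true_left, Set.mem_ofPred_eq, Set.mem_sdiff, Set.mem_preimage, hmem,
      not_le]
    tauto
  have hpm : ∀ s : ℝ, MeasurableSet ((fun G => G + s • c) ⁻¹' Q) := fun s =>
    hQm.preimage (by fun_prop)
  have hreal : ∀ s : ℝ, ∫ G, f (G + s • c) ∂(gaussianVec Ω v) =
      (gaussianVec Ω v).real ((fun G => G + s • c) ⁻¹' Q) := fun s => by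
    rw [← integral_indicator_one (hpm s)]
    rfl
  rw [hreal] at k1 k2
  have hss : (fun G => G + ε • c) ⁻¹' Q ⊆ (fun G => G + (-ε) • c) ⁻¹' Q := fun G hG => hmono G hG
  rw [← ofReal_measureReal, hSeq, measureReal_sdiff hss (hpm ε)]
  refine ENNReal.ofReal_le_ofReal ?_
  have h1 := (abs_le.1 k1).1
  have h2 := (abs_le.1 k2).2
  linarith

end Events

/-! ### Choice of scales and linear growth with high probability. -/

section Growth

open Finset Matrix
open scoped NNReal ENNReal

/-- The worst case grows linearly in the distance to some optimal strategy. -/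
def HasLinearGrowth {ι κ : Type*} [Fintype ι] [Fintype κ] [Nonempty κ] (A : Matrix ι κ ℝ)
    (κ₀ : ℝ) : Prop :=
  ∃ x₀ ∈ stdSimplex ℝ ι, worst A x₀ = gameValue A ∧
    ∀ x ∈ stdSimplex ℝ ι, ∀ i, κ₀ * |x i - x₀ i| ≤ worst A x - gameValue A

variable {Ω ι κ : Type*} [Fintype Ω] [Fintype ι] [Fintype κ] [Nonempty ι] [Nonempty κ]
  [DecidableEq ι] [DecidableEq κ]

theorem hasLinearGrowth_of_isRobust {A : Matrix ι κ ℝ} {N M ε η₁ τ₁ η h : ℝ}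
    (hι : Fintype.card ι ≤ N) (hκ : Fintype.card κ ≤ N) (hN : 1 ≤ N) (hM1 : 1 ≤ M) (hε : 0 < ε)
    (hη₁ : 0 ≤ η₁) (hηε : N * η₁ * M ≤ ε / 2) (hτ₁ : 0 < τ₁) (hτ₁M : τ₁ ≤ M) (hτ₁ε : τ₁ ≤ ε / 2)
    (hη : η = τ₁ / (3 * N * M)) (hh : 0 < h)
    (hM : ∀ i j, |A i j| ≤ M) (hcol : ColDichotomy A ε) (hrow : ColDichotomy (negTranspose A) ε)
    (hrob : IsRobust A η (h * η / 4))
    (hrob' : ∀ i : ι, ∀ _ : Nonempty {k // k ≠ i}, IsRobust (deleteCol (negTranspose A) i) η₁ τ₁) :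
    HasLinearGrowth A (h / 4) := by
  have hη0 : 0 < η := by rw [hη]; positivity
  have hηM : N * η * M = τ₁ / 3 := by rw [hη]; field_simp
  have hcard : Fintype.card ι * η * M ≤ ε / 2 := by
    have : Fintype.card ι * η * M ≤ N * η * M := by gcongr
    linarith
  have hcard' : Fintype.card κ * η₁ * M ≤ ε / 2 := by
    have : Fintype.card κ * η₁ * M ≤ N * η₁ * M := by gcongr
    linarith
  obtain ⟨x₀, hx₀, hopt⟩ := exists_worst_eq_gameValue A
  have hτ : 0 ≤ h * η / 4 := by positivity
  refine ⟨x₀, hx₀, hopt, fun x hx i => ?_⟩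
  refine linear_growth (α := τ₁ / (3 * M)) (β := ε / 2) hx₀ hopt hrob hη0 (by positivity) hM
    (weight_of_rowDichotomy hε hτ₁ hτ₁M hrow hrob' hM hcard' hτ₁ε hx₀ hopt)
    (slack_of_colDichotomy hε hτ hcol hrob hM hcard hx₀ hopt) ?_ hcard (by linarith) hx i
  rw [hη]
  gcongr
  nlinarith

/-- The modulus of linear growth guaranteed up to a failure probability `5 * p`. -/
noncomputable def growthModulus (σ p N : ℝ) : ℝ := σ ^ 4 * p ^ 7 / (393216 * N ^ 15)

theorem measure_not_hasLinearGrowth_le {A : (Ω → ℝ) → Matrix ι κ ℝ} {N σ p : ℝ}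
    (hA : IsNoisy A N) (hι : Fintype.card ι ≤ N) (hκ : Fintype.card κ ≤ N) (hN : 1 ≤ N)
    (hσ : 0 < σ) (hσ1 : σ ≤ 1) (hp : 0 < p) (hp1 : p ≤ 1)
    (hM : gaussianVec Ω (σ ^ 2).toNNReal {G | ¬ ∀ i j, |A G i j| ≤ 2 * N / p} ≤
      ENNReal.ofReal p) :
    gaussianVec Ω (σ ^ 2).toNNReal {G | ¬ HasLinearGrowth (A G) (growthModulus σ p N)} ≤
      ENNReal.ofReal (5 * p) := by
  have hN0 : 0 < N := by linarith
  have hvr : (((σ ^ 2).toNNReal : ℝ≥0) : ℝ) = σ ^ 2 := Real.coe_toNNReal _ (sq_nonneg _)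
  have hv : (σ ^ 2).toNNReal ≠ 0 := (Real.toNNReal_pos.2 (by positivity)).ne'
  set μ := gaussianVec Ω (σ ^ 2).toNNReal with hμ
  set M := 2 * N / p with hMdef
  -- The scales `ε`, `h₁`, `h` give their bad events probability at most `p`, with `q` equal to the
  -- scale times `N / σ`; `h₁` carries an extra `N` for the union over deleted rows. `η₁` is tuned
  -- to `N * η₁ * M = ε / 2`, and `η` to stay below the weight bound `τ₁ / (3 * M)`.
  obtain ⟨ε, hεdef⟩ : ∃ ε, ε = σ * p / (4 * N ^ 2) := ⟨_, rfl⟩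
  obtain ⟨η₁, hη₁def⟩ : ∃ η₁, η₁ = ε * p / (4 * N ^ 2) := ⟨_, rfl⟩
  obtain ⟨h₁, hh₁def⟩ : ∃ h₁, h₁ = p * σ * η₁ / (4 * N ^ 3) := ⟨_, rfl⟩
  obtain ⟨τ₁, hτ₁def⟩ : ∃ τ₁, τ₁ = h₁ * η₁ / 4 := ⟨_, rfl⟩
  obtain ⟨η, hηdef⟩ : ∃ η, η = τ₁ / (3 * N * M) := ⟨_, rfl⟩
  obtain ⟨h, hhdef⟩ : ∃ h, h = p * σ * η / (4 * N ^ 2) := ⟨_, rfl⟩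
  have hM1 : 1 ≤ M := by
    rw [hMdef, le_div_iff₀ hp]; linarith
  have hε : 0 < ε := by rw [hεdef]; positivity
  have hη₁ : 0 < η₁ := by rw [hη₁def]; positivity
  have hh₁ : 0 < h₁ := by rw [hh₁def]; positivity
  have hτ₁ : 0 < τ₁ := by rw [hτ₁def]; positivity
  have hη : 0 < η := by rw [hηdef]; positivity
  have hh : 0 < h := by rw [hhdef]; positivity
  have hNpow : ∀ k : ℕ, 1 ≤ N ^ k := fun k => one_le_pow₀ hN
  have hsmall : ∀ {a : ℝ} (k : ℕ), 0 ≤ a → a / (4 * N ^ k) ≤ a := fun k ha =>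
    div_le_self ha (by linarith [hNpow k])
  have hσp1 : σ * p ≤ 1 := mul_le_one₀ hσ1 hp.le hp1
  have hε1 : ε ≤ 1 := by rw [hεdef]; exact (hsmall 2 (by positivity)).trans hσp1
  have hη₁1 : η₁ ≤ 1 := by
    rw [hη₁def]; exact (hsmall 2 (by positivity)).trans (mul_le_one₀ hε1 hp.le hp1)
  have hh₁1 : h₁ ≤ 1 := by
    rw [hh₁def]
    exact (hsmall 3 (by positivity)).trans
      (mul_le_one₀ (mul_le_one₀ hp1 hσ.le hσ1) hη₁.le hη₁1)
  have hηε : N * η₁ * M = ε / 2 := by rw [hη₁def, hMdef]; field_simp; norm_num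
  have hη₁ε : η₁ ≤ ε / 2 := by
    rw [← hηε]
    have : 1 ≤ N * M := one_le_mul_of_one_le_of_one_le hN hM1
    nlinarith
  have hτ₁η : τ₁ ≤ η₁ := by rw [hτ₁def]; nlinarith
  have hη1 : η ≤ 1 := by
    rw [hηdef, div_le_one (by positivity)]
    have : 1 ≤ N * M := one_le_mul_of_one_le_of_one_le hN hM1
    nlinarith
  have hmod : growthModulus σ p N = h / 4 := by
    rw [hhdef, hηdef, hτ₁def, hh₁def, hη₁def, hεdef, hMdef, growthModulus]
    field_simp; norm_num
  have e1 : μ {G | ¬ ColDichotomy (A G) ε} ≤ ENNReal.ofReal p := by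
    refine (measure_not_colDichotomy_le hA hv hε (q := ε * N / σ) (B := N) (by positivity) ?_ ?_
      hκ).trans (ENNReal.ofReal_le_ofReal ?_)
    · rw [hεdef, div_le_one hσ]
      have : σ * p / (4 * N ^ 2) * N = σ * (p / (4 * N)) := by field_simp
      rw [this]
      exact mul_le_of_le_one_right hσ.le ((div_le_one (by positivity)).2 (by linarith))
    · rw [hvr, div_pow, div_mul_cancel₀ _ (by positivity), mul_pow]
      gcongr; nlinarith
    · rw [hεdef]; apply le_of_eq; field_simp
  have e2 : μ {G | ¬ ColDichotomy (negTranspose (A G)) ε} ≤ ENNReal.ofReal p := by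
    refine (measure_not_colDichotomy_le hA.negTranspose hv hε (q := ε * N / σ) (B := N)
      (by positivity) ?_ ?_ hι).trans (ENNReal.ofReal_le_ofReal ?_)
    · rw [hεdef, div_le_one hσ]
      have : σ * p / (4 * N ^ 2) * N = σ * (p / (4 * N)) := by field_simp
      rw [this]
      exact mul_le_of_le_one_right hσ.le ((div_le_one (by positivity)).2 (by linarith))
    · rw [hvr, div_pow, div_mul_cancel₀ _ (by positivity), mul_pow]
      gcongr; nlinarith
    · rw [hεdef]; apply le_of_eq; field_simp
  have e3 : μ {G | ¬ IsRobust (A G) η (h * η / 4)} ≤ ENNReal.ofReal p := by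
    refine (measure_not_isRobust_le hA hv hh hη (q := h * N / σ) (B := N) (by positivity) ?_ ?_
      hι).trans (ENNReal.ofReal_le_ofReal ?_)
    · have : h * N / σ = p * η / (4 * N ^ 1) := by rw [hhdef]; field_simp
      rw [this]
      exact (hsmall 1 (by positivity)).trans (mul_le_one₀ hp1 hη.le hη1)
    · rw [hvr, div_pow, div_mul_cancel₀ _ (by positivity), mul_pow]
      gcongr; nlinarith
    · rw [hhdef]; apply le_of_eq; field_simp
  have e4 : μ {G | ∃ i : ι, ∃ _ : Nonempty {k // k ≠ i},
      ¬ IsRobust (deleteCol (negTranspose (A G)) i) η₁ τ₁} ≤ ENNReal.ofReal p := by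
    refine (measure_exists_le (p := N * (4 * (h₁ * N / σ) / η₁)) _ (by positivity) hι
      fun i => ?_).trans (ENNReal.ofReal_le_ofReal ?_)
    · by_cases hne : Nonempty {k // k ≠ i}
      · simp only [hne, exists_true_left, hτ₁def]
        refine measure_not_isRobust_le (hA.negTranspose.deleteCol i) hv hh₁ hη₁ (by positivity)
          ?_ ?_ hκ
        · have : h₁ * N / σ = p * η₁ / (4 * N ^ 2) := by rw [hh₁def]; field_simp
          rw [this]
          exact (hsmall 2 (by positivity)).trans (mul_le_one₀ hp1 hη₁.le hη₁1)
        · rw [hvr, div_pow, div_mul_cancel₀ _ (by positivity), mul_pow]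
          gcongr; nlinarith
      · simp [hne]
    · rw [hh₁def]; apply le_of_eq; field_simp
  have hsub : {G | ¬ HasLinearGrowth (A G) (growthModulus σ p N)} ⊆
      {G | ¬ ∀ i j, |A G i j| ≤ M} ∪ ({G | ¬ ColDichotomy (A G) ε} ∪
        ({G | ¬ ColDichotomy (negTranspose (A G)) ε} ∪
          ({G | ¬ IsRobust (A G) η (h * η / 4)} ∪ {G | ∃ i : ι, ∃ _ : Nonempty {k // k ≠ i},
            ¬ IsRobust (deleteCol (negTranspose (A G)) i) η₁ τ₁}))) := by
    intro G hG
    by_contra hcon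
    simp only [Set.mem_union, Set.mem_ofPred_eq, not_or, not_not, not_exists] at hcon
    obtain ⟨g1, g2, g3, g4, g5⟩ := hcon
    refine hG (hmod ▸ hasLinearGrowth_of_isRobust hι hκ hN hM1 hε hη₁.le hηε.le hτ₁ ?_ ?_ hηdef hh
      g1 g2 g3 g4 g5)
    · linarith
    · linarith
  have hsum : ENNReal.ofReal (5 * p) = ENNReal.ofReal p + (ENNReal.ofReal p + (ENNReal.ofReal p +
      (ENNReal.ofReal p + ENNReal.ofReal p))) := by
    rw [← ENNReal.ofReal_add, ← ENNReal.ofReal_add, ← ENNReal.ofReal_add, ← ENNReal.ofReal_add]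
    · congr 1; ring
    all_goals positivity
  rw [hsum]
  refine (measure_mono hsub).trans ((measure_union_le _ _).trans (add_le_add hM
    ((measure_union_le _ _).trans (add_le_add e1 ((measure_union_le _ _).trans (add_le_add e2
      ((measure_union_le _ _).trans (add_le_add e3 e4))))))))

end Growth

/-! ### From linear growth to the error bound for the perturbed game. -/

section Bridge

open Finset Matrix

variable {n m : ℕ}

theorem payoff_eq (A : Matrix (Fin n) (Fin m) ℝ) (x : Fin n → ℝ) (y : Fin m → ℝ) :
    payoff A x y = (x ᵥ* A) ⬝ᵥ y := dotProduct_mulVec x A y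

theorem maxPayoff_eq [Nonempty (Fin m)] (A : Matrix (Fin n) (Fin m) ℝ) (x : Fin n → ℝ) :
    maxPayoff A x = worst A x := by
  have hle : ∀ y : stdSimplex ℝ (Fin m), payoff A x y ≤ worst A x := fun y => by
    rw [payoff_eq]; exact vecMul_dotProduct_le A x y.2
  have : Nonempty (stdSimplex ℝ (Fin m)) := stdSimplex_nonempty.to_subtype
  refine le_antisymm (ciSup_le hle) (worst_le_iff.2 fun j => ?_)
  have := le_ciSup (f := fun y : stdSimplex ℝ (Fin m) => payoff A x y)
    ⟨worst A x, by rintro _ ⟨y, rfl⟩; exact hle y⟩ ⟨_, single_mem_stdSimplex ℝ j⟩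
  change payoff A x (Pi.single j 1) ≤ maxPayoff A x at this
  rwa [payoff_eq, dotProduct_single, mul_one] at this

theorem minPayoff_eq [Nonempty (Fin n)] (A : Matrix (Fin n) (Fin m) ℝ) (y : Fin m → ℝ) :
    minPayoff A y = -worst (negTranspose A) y := by
  have hpay : ∀ x, payoff A x y = -((y ᵥ* negTranspose A) ⬝ᵥ x) := fun x => by
    have : y ᵥ* negTranspose A = -(A *ᵥ y) := by
      ext i; simp [vecMul_negTranspose]
    rw [this, neg_dotProduct, neg_neg, dotProduct_comm]
    rfl
  have hle : ∀ x : stdSimplex ℝ (Fin n), -worst (negTranspose A) y ≤ payoff A x y := fun x => by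
    rw [hpay]; exact neg_le_neg (vecMul_dotProduct_le _ y x.2)
  have : Nonempty (stdSimplex ℝ (Fin n)) := stdSimplex_nonempty.to_subtype
  refine le_antisymm (le_neg.1 (worst_le_iff.2 fun i => le_neg.1 ?_)) (le_ciInf hle)
  have := ciInf_le (f := fun x : stdSimplex ℝ (Fin n) => payoff A x y)
    ⟨-worst (negTranspose A) y, by rintro _ ⟨x, rfl⟩; exact hle x⟩ ⟨_, single_mem_stdSimplex ℝ i⟩
  change minPayoff A y ≤ payoff A (Pi.single i 1) y at this
  rwa [hpay, dotProduct_single, mul_one] at this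

theorem value_eq [Nonempty (Fin m)] (A : Matrix (Fin n) (Fin m) ℝ) : value A = gameValue A := by
  simp only [value, gameValue, maxPayoff_eq]

theorem optX_eq [Nonempty (Fin m)] (A : Matrix (Fin n) (Fin m) ℝ) :
    optX A = {x | x ∈ stdSimplex ℝ (Fin n) ∧ worst A x ≤ gameValue A} := by
  simp only [optX, maxPayoff_eq, value_eq]

theorem optY_eq [Nonempty (Fin n)] [Nonempty (Fin m)] (A : Matrix (Fin n) (Fin m) ℝ) :
    optY A = {y | y ∈ stdSimplex ℝ (Fin m) ∧
      worst (negTranspose A) y ≤ gameValue (negTranspose A)} := by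
  simp only [optY, minPayoff_eq, value_eq, gameValue_negTranspose, le_neg]

theorem isCompact_setOf_worst_le {ι κ : Type*} [Fintype ι] [Fintype κ] [Nonempty κ]
    (A : Matrix ι κ ℝ) (t : ℝ) : IsCompact {x | x ∈ stdSimplex ℝ ι ∧ worst A x ≤ t} :=
  (isCompact_stdSimplex ℝ ι).inter_right (isClosed_le (continuous_worst A) continuous_const)

theorem continuous_pairNorm :
    Continuous (pairNorm : (Fin n → ℝ) × (Fin m → ℝ) → ℝ) := by
  unfold pairNorm
  fun_prop

theorem norm_toLp_le {ι : Type*} [Fintype ι] {N s : ℝ} (hN : 1 ≤ N) (hι : Fintype.card ι ≤ N)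
    (hs : 0 ≤ s) {u : ι → ℝ} (hu : ∀ i, |u i| ≤ s) : ‖WithLp.toLp 2 u‖ ≤ N * s := by
  rw [EuclideanSpace.norm_eq]
  refine Real.sqrt_le_iff.2 ⟨by positivity, ?_⟩
  calc ∑ i, ‖u i‖ ^ 2 ≤ ∑ _i : ι, s ^ 2 := sum_le_sum fun i _ => by
        rw [Real.norm_eq_abs]; exact pow_le_pow_left₀ (abs_nonneg _) (hu i) 2
    _ = Fintype.card ι * s ^ 2 := by simp
    _ ≤ N * s ^ 2 := by gcongr
    _ ≤ (N * s) ^ 2 := by rw [mul_pow]; gcongr; nlinarith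

theorem pairNorm_le (z : (Fin n → ℝ) × (Fin m → ℝ)) :
    pairNorm z ≤ ‖WithLp.toLp 2 z.1‖ + ‖WithLp.toLp 2 z.2‖ := by
  rw [pairNorm, WithLp.prod_norm_eq_of_L2]
  refine Real.sqrt_le_iff.2 ⟨by positivity, ?_⟩
  have := mul_nonneg (norm_nonneg (WithLp.toLp 2 z.1)) (norm_nonneg (WithLp.toLp 2 z.2))
  change ‖WithLp.toLp 2 z.1‖ ^ 2 + ‖WithLp.toLp 2 z.2‖ ^ 2 ≤ _
  nlinarith

/-- Linear growth for both players gives the error bound for the duality gap. -/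
theorem errorBound_of_hasLinearGrowth [Nonempty (Fin n)] [Nonempty (Fin m)]
    {A : Matrix (Fin n) (Fin m) ℝ} {N κ₀ κ : ℝ} (hN : 1 ≤ N) (hn : (n : ℝ) ≤ N) (hm : (m : ℝ) ≤ N)
    (hκ₀ : 0 < κ₀) (hX : HasLinearGrowth A κ₀) (hY : HasLinearGrowth (negTranspose A) κ₀)
    (hκ : 0 < κ) (hκle : κ ≤ κ₀ / N) : ErrorBound A κ := by
  obtain ⟨x₀, hx₀, hxopt, hx⟩ := hX
  obtain ⟨y₀, hy₀, hyopt, hy⟩ := hY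
  refine ⟨hκ, fun z hz => ?_⟩
  have hmem : (x₀, y₀) ∈ optX A ×ˢ optY A := by
    rw [optX_eq, optY_eq]
    exact ⟨⟨hx₀, hxopt.le⟩, ⟨hy₀, hyopt.le⟩⟩
  have hcomp : IsCompact (optX A ×ˢ optY A) := by
    rw [optX_eq, optY_eq]
    exact (isCompact_setOf_worst_le _ _).prod (isCompact_setOf_worst_le _ _)
  obtain ⟨p, hp, hpmin⟩ := hcomp.exists_isMinOn ⟨_, hmem⟩
    (f := fun q => pairNorm (z - q)) (continuous_pairNorm.comp (by fun_prop)).continuousOn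
  refine ⟨p, ⟨hp, fun q hq => hpmin hq⟩, ?_⟩
  have hgx : ∀ i, |(z.1 - x₀) i| ≤ (worst A z.1 - gameValue A) / κ₀ := fun i => by
    rw [le_div_iff₀ hκ₀, mul_comm]; exact hx z.1 hz.1 i
  have hgy : ∀ j, |(z.2 - y₀) j| ≤
      (worst (negTranspose A) z.2 - gameValue (negTranspose A)) / κ₀ := fun j => by
    rw [le_div_iff₀ hκ₀, mul_comm]; exact hy z.2 hz.2 j
  have h1 := norm_toLp_le hN (by simpa using hn)
    (div_nonneg (sub_nonneg.2 (gameValue_le A hz.1)) hκ₀.le) hgx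
  have h2 := norm_toLp_le hN (by simpa using hm)
    (div_nonneg (sub_nonneg.2 (gameValue_le (negTranspose A) hz.2)) hκ₀.le) hgy
  -- The projection is no farther than the particular equilibrium `(x₀, y₀)`, so growth around that
  -- single point suffices.
  have h3 : pairNorm (z - p) ≤ pairNorm (z - (x₀, y₀)) := hpmin hmem
  have h4 : pairNorm (z - (x₀, y₀)) ≤ N * (dualityGap A z.1 z.2 / κ₀) := by
    refine (pairNorm_le _).trans ((add_le_add h1 h2).trans (le_of_eq ?_))
    rw [dualityGap, maxPayoff_eq, minPayoff_eq, gameValue_negTranspose]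
    ring
  calc κ * pairNorm (z - p) ≤ κ₀ / N * (N * (dualityGap A z.1 z.2 / κ₀)) :=
        mul_le_mul hκle (h3.trans h4) (norm_nonneg _) (by positivity)
    _ = dualityGap A z.1 z.2 := by field_simp

theorem isNoisy_perturbed (Abar : Matrix (Fin n) (Fin m) ℝ) {N : ℝ} (hn : (n : ℝ) ≤ N)
    (hm : (m : ℝ) ≤ N) : IsNoisy (perturbed Abar) N where
  continuous := by
    refine continuous_const.add (continuous_pi fun i => continuous_pi fun j => ?_)
    exact continuous_apply (i, j)
  row i := by
    refine ⟨fun k => if k.1 = i then 1 else 0, ?_, fun G h => ?_⟩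
    · rw [Fintype.sum_prod_type_right]; simpa using hm
    · ext i' j
      simp [perturbed, rowOnes, add_assoc]
  col j := by
    refine ⟨fun k => if k.2 = j then 1 else 0, ?_, fun G h => ?_⟩
    · rw [Fintype.sum_prod_type]; simpa using hn
    · ext i j'
      simp [perturbed, colOnes, add_assoc]

/-- Chebyshev and a union bound over entries suffice: a bound on the entries polynomial in `N / p`
is all that is needed. -/
theorem measure_entry_gt_le {Abar : Matrix (Fin n) (Fin m) ℝ}
    (hA : ∀ i j, Abar i j ∈ Set.Icc (-1 : ℝ) 1) {σ p N : ℝ} (hσ : 0 < σ) (hσ1 : σ ≤ 1)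
    (hp : 0 < p) (hp1 : p ≤ 1) (hN : 1 ≤ N) (hnm : (n : ℝ) * m ≤ N) :
    gaussianVec (Fin n × Fin m) (σ ^ 2).toNNReal
      {G | ¬ ∀ i j, |perturbed Abar G i j| ≤ 2 * N / p} ≤ ENNReal.ofReal p := by
  have hNp : 1 ≤ N / p := (one_le_div hp).2 (by linarith)
  refine (measure_mono (t := {G | ∃ k, N / p ≤ |G k|}) fun G hG => ?_).trans
    ((measure_exists_abs_ge_le (t := N / p) (B := N) (by positivity) (by simpa using hnm)).trans
      (ENNReal.ofReal_le_ofReal ?_))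
  · simp only [Set.mem_ofPred_eq, not_forall, not_le] at hG
    obtain ⟨i, j, hij⟩ := hG
    refine ⟨(i, j), ?_⟩
    have h1 : |perturbed Abar G i j| ≤ |Abar i j| + |G (i, j)| := abs_add_le _ _
    have h2 : |Abar i j| ≤ 1 := abs_le.2 (hA i j)
    have h3 : 2 * N / p = N / p + N / p := by ring
    linarith
  · rw [Real.coe_toNNReal _ (sq_nonneg σ)]
    have e : N * (σ ^ 2 / (N / p) ^ 2) = (σ ^ 2 * (p / N)) * p := by field_simp
    rw [e]
    have h1 : p / N ≤ 1 := (div_le_one (by linarith)).2 (by linarith)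
    exact mul_le_of_le_one_left hp.le (mul_le_one₀ (pow_le_one₀ hσ.le hσ1) (by positivity) h1)

theorem measure_not_errorBound_le {Abar : Matrix (Fin n) (Fin m) ℝ} (hn0 : 0 < n) (hm0 : 0 < m)
    (hA : ∀ i j, Abar i j ∈ Set.Icc (-1 : ℝ) 1) {σ p : ℝ} (hσ : 0 < σ) (hσ1 : σ ≤ 1)
    (hp : 0 < p) (hp1 : p ≤ 1) :
    gaussianNoise n m σ {G | ¬ ∀ κ : ℝ, 0 < κ →
      κ ≤ growthModulus σ p ((n : ℝ) * m) / ((n : ℝ) * m) → ErrorBound (perturbed Abar G) κ} ≤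
      ENNReal.ofReal (10 * p) := by
  have : Nonempty (Fin n) := ⟨⟨0, hn0⟩⟩
  have : Nonempty (Fin m) := ⟨⟨0, hm0⟩⟩
  have hn1 : (1 : ℝ) ≤ n := by exact_mod_cast hn0
  have hm1 : (1 : ℝ) ≤ m := by exact_mod_cast hm0
  set N : ℝ := (n : ℝ) * m with hNdef
  have hn : (n : ℝ) ≤ N := le_mul_of_one_le_right (by linarith) hm1
  have hm : (m : ℝ) ≤ N := le_mul_of_one_le_left (by linarith) hn1
  have hN : 1 ≤ N := hn1.trans hn
  have hbound := measure_entry_gt_le hA hσ hσ1 hp hp1 hN le_rfl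
  have hnoisy := isNoisy_perturbed Abar hn hm
  have hX := measure_not_hasLinearGrowth_le hnoisy (by simpa using hn) (by simpa using hm) hN
    hσ hσ1 hp hp1 hbound
  have hY := measure_not_hasLinearGrowth_le hnoisy.negTranspose (by simpa using hm)
    (by simpa using hn) hN hσ hσ1 hp hp1 (by
      refine (measure_mono fun G hG => ?_).trans hbound
      simp only [Set.mem_ofPred_eq, negTranspose_apply, abs_neg] at hG ⊢
      exact fun h => hG fun j i => h i j)
  have hpos : 0 < growthModulus σ p N := by unfold growthModulus; positivity
  have hsum : ENNReal.ofReal (10 * p) = ENNReal.ofReal (5 * p) + ENNReal.ofReal (5 * p) := by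
    rw [← ENNReal.ofReal_add (by positivity) (by positivity)]
    congr 1; ring
  rw [hsum]
  refine (measure_mono fun G hG => ?_).trans ((measure_union_le _ _).trans (add_le_add hX hY))
  by_contra hcon
  simp only [Set.mem_union, Set.mem_ofPred_eq, not_or, not_not] at hcon
  exact hG fun κ hκ hκle => errorBound_of_hasLinearGrowth hN hn hm hpos hcon.1 hcon.2 hκ hκle

end Bridge

end ZeroSumGame

theorem theorem2 (K : ℝ) (hK : 0 < K) (c : ℕ) :
    ∃ C : ℝ, 0 < C ∧ ∃ a b : ℕ, ∀ (n m : ℕ), 0 < n → 0 < m →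
      ∀ σ : ℝ, 0 < σ → σ ^ 2 ≤ 1 →
      ∀ Abar : Matrix (Fin n) (Fin m) ℝ, (∀ i j, Abar i j ∈ Set.Icc (-1 : ℝ) 1) →
        ZeroSumGame.gaussianNoise n m σ
          {G | ¬ ∀ κ : ℝ, 0 < κ → κ ≤ C * σ ^ a * (1 / ((n : ℝ) * (m : ℝ))) ^ b →
            ZeroSumGame.ErrorBound (ZeroSumGame.perturbed Abar G) κ}
          ≤ ENNReal.ofReal (1 / (K * ((n : ℝ) * (m : ℝ)) ^ c)) := by
  -- Failure has probability at most `10 * p`, five events for each player; the minimum with `1`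
  -- keeps `p = k / (n * m) ^ c` at most `1`.
  obtain ⟨k, hkdef⟩ : ∃ k, k = min 1 (1 / K) / 10 := ⟨_, rfl⟩
  have hmin : 0 < min 1 (1 / K) := lt_min one_pos (by positivity)
  have hk : 0 < k := by rw [hkdef]; positivity
  have hk1 : k ≤ 1 := by rw [hkdef]; linarith [min_le_left 1 (1 / K)]
  have hkK : 10 * k ≤ 1 / K := by rw [hkdef]; linarith [min_le_right 1 (1 / K)]
  -- In the exponent of `1 / (n * m)`, `7 * c` comes from `p ^ 7`, `15` from `growthModulus`, and
  -- one more from passing from sup-norm to Euclidean distance.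
  refine ⟨k ^ 7 / 393216, by positivity, 4, 7 * c + 16, fun n m hn hm σ hσ hσ2 Abar hA => ?_⟩
  have hn1 : (1 : ℝ) ≤ n := by exact_mod_cast hn
  have hm1 : (1 : ℝ) ≤ m := by exact_mod_cast hm
  have hσ1 : σ ≤ 1 := by nlinarith
  have hN : (1 : ℝ) ≤ (n : ℝ) * m := one_le_mul_of_one_le_of_one_le hn1 hm1
  have hNc : (1 : ℝ) ≤ ((n : ℝ) * m) ^ c := one_le_pow₀ hN
  have hmain := ZeroSumGame.measure_not_errorBound_le hn hm hA hσ hσ1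
    (p := k / ((n : ℝ) * m) ^ c) (by positivity)
    ((div_le_one (by positivity)).2 (hk1.trans hNc))
  have hmod : ZeroSumGame.growthModulus σ (k / ((n : ℝ) * m) ^ c) ((n : ℝ) * m) / ((n : ℝ) * m) =
      k ^ 7 / 393216 * σ ^ 4 * (1 / ((n : ℝ) * m)) ^ (7 * c + 16) := by
    have hN0 : (n : ℝ) * m ≠ 0 := by positivity
    generalize (n : ℝ) * m = N at hN0
    rw [ZeroSumGame.growthModulus, div_pow, ← pow_mul, one_div, inv_pow, pow_add, mul_comm c 7]
    field_simp
  rw [hmod] at hmain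
  refine hmain.trans (ENNReal.ofReal_le_ofReal ?_)
  calc 10 * (k / ((n : ℝ) * m) ^ c) = 10 * k / ((n : ℝ) * m) ^ c := by ring
    _ ≤ 1 / K / ((n : ℝ) * m) ^ c := by gcongr
    _ = 1 / (K * ((n : ℝ) * m) ^ c) := by rw [div_div]
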